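/- **Setting.** Let $\mathcal P=\{P_1,\dots,P_n\}$, let $\mathcal Z\subseteq 2^{\mathcal P}$ describe the adversary structure, and let $P_S\in\mathcal P$ be the sender. A set $C\subseteq\mathcal P$ is *corruptible* if $C\subseteq Z$ for some $Z\in\mathcal Z$ (if $\mathcal Z$ is closed under subsets, this is $C\in\mathcal Z$). $\mathcal Z$ satisfies $\mathbb Q^{(3)}(\mathcal P,\mathcal Z)$ if $\mathcal P\not\subseteq Z_1\cup Z_2\cup Z_3$ for all $Z_1,Z_2,Z_3\in\mathcal Z$ (repetitions allowed). All machines below are probabilistic and computationally unbounded. **Protocol $\Pi_{\mathsf{Acast}}$ for $\ell$-bit messages.** The sender, on its (first) input $m\in\{0,1\}^\ell$, sends $(\mathsf{inp},m)$ to all parties. Each party $P_i$ (including $P_S$): (1) on receiving the first $(\mathsf{inp},m)$ from $P_S$, sends $(\mathsf{echo},m)$ to all parties; (2) if $(\mathsf{echo},m')$ has been received from all parties of $\mathcal P\setminus Z$ for some $Z\in\mathcal Z$, sends $(\mathsf{ready},m')$ to all parties; (3) if $(\mathsf{ready},m')$ has been received from a set of parties that is not corruptible, sends $(\mathsf{ready},m')$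 to all parties; (4) if $(\mathsf{ready},m')$ has been received from all parties of $\mathcal P\setminus Z$ for some $Z\in\mathcal Z$, outputs $m'$. A party sends at most one $\mathsf{echo}$ and at most one $\mathsf{ready}$ message to each party and outputs at most once. A message is a bit string consisting of a 2-bit tag and $\ell$ bits of content; ill-formed strings are ignored. **Real world.** A static malicious adversary $\mathsf{Adv}$ controls a corruptible set $Z^\star$ and has an auxiliary input $z$. The environment $\mathsf{Env}$ repeatedly either activates a party, possibly with an input, or sends a message to $\mathsf{Adv}$ and gets an answer, until it stops with an output bit. The parties are connected by pairwise secure (private and authenticated) asynchronous channels: $\mathsf{Adv}$ sees messages to corrupt parties and the lengths and delivery status of all others, may send messages on behalf of corrupt parties, and may at any of its activations delay any message by finitely many further activations of its recipient. When $\mathsf{Env}$ activates an honest party, $\mathsf{Adv}$ is told (and may act and send $\mathsf{Env}$ a message), then the party receives the messages that are due, computes, sends messages, and possibly hands an output to $\mathsf{Env}$, to which control returns. An activation of a corrupt party is passed to $\mathsf{Adv}$. **Ideal world with $\mathcal F_{\mathsf{Acast}}$.** Honest dummy parties forward inputs to $\mathcal F_{\mathsf{Acast}}$, and each activation of an honest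 dummy party is also a request for its output. On the first message $m\in\{0,1\}^\ell$ from $P_S$ (from the simulator $\mathcal S$ if $P_S\in Z^\star$), $\mathcal F_{\mathsf{Acast}}$ records $m$, sends $m$ to $\mathcal S$ if $P_S$ is honest, and prepares a request-based delayed output $m$ for every honest party: $\mathcal S$ is told about each activation of an honest party and may instruct $\mathcal F_{\mathsf{Acast}}$ to ignore a finite number of further requests of a party; a request that is not ignored is answered with $m$, once per party. **Perfect UC security.** $\Pi$ *UC-securely realizes* $\mathcal F$ *with perfect security* if for every $\mathsf{Adv}$ there is a simulator $\mathcal S$ such that * $\mathcal S$ consists of one copy of the real-world execution with $\mathsf{Adv}$ and virtual honest parties, advanced by exactly one event per activation of $\mathcal S$, together with a finite-state control (so that its running time is linear in that of the virtual execution, in particular polynomial in that of $\mathsf{Adv}$); * if $\mathsf{Adv}$ respects eventual delivery (in every infinite execution in which all honest parties are activated infinitely often, every message between honest parties is delivered), then so does $\mathcal S$ (in every infinite ideal execution in which all honest parties are activated infinitely often, every honest party for which an output is prepared obtains it); * for every corruptible $Z^\star$, every $z\in\{0,1\}^\star$, every environment $\mathsf{Env}$ and every $k$, the output of $\mathsf{Env}$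 within its first $k$ activations has the same distribution in the real world with $\Pi,\mathsf{Adv}$ and in the ideal world with $\mathcal F,\mathcal S$. **Theorem.** There is an absolute constant $c$ such that for all $n$, all $\mathcal Z$ satisfying $\mathbb Q^{(3)}(\mathcal P,\mathcal Z)$, every sender $P_S$ and every $\ell\ge 0$: the protocol $\Pi_{\mathsf{Acast}}$ UC-securely realizes $\mathcal F_{\mathsf{Acast}}$ with perfect security; and if $\ell\ge 1$, then in every execution, whatever the environment and the adversary (corrupting any corruptible set) do, the honest parties send at most $c\,n^2\ell$ bits in total, i.e. the protocol incurs a communication of $O(n^2\ell)$ bits. -/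

import Mathlib

namespace AsyncUC

/-! ### Adversary structures -/

/-- `Q k P 𝒵`: no `k` (not necessarily distinct) members of `𝒵` cover `P`. -/
def Q {n : ℕ} (k : ℕ) (P : Finset (Fin n)) (𝒵 : Finset (Finset (Fin n))) : Prop :=
  ∀ Z : Fin k → Finset (Fin n), (∀ j, Z j ∈ 𝒵) → ¬ P ⊆ Finset.univ.biUnion Z

/-- `C` may be corrupted: `C` lies in the adversary structure given by `𝒵`. If `𝒵` lists all the
corruptible sets (so that it is closed under subsets) this is `C ∈ 𝒵`; if `𝒵` lists only the maximal
ones, it is membership in the structure they generate. -/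
abbrev Corruptible {n : ℕ} (𝒵 : Finset (Finset (Fin n))) (C : Finset (Fin n)) : Prop :=
  ∃ Z ∈ 𝒵, C ⊆ Z

/-- `C` contains `P \ Z` for some `Z ∈ 𝒵`. -/
abbrev IsQuorum {n : ℕ} (𝒵 : Finset (Finset (Fin n))) (C : Finset (Fin n)) : Prop :=
  ∃ Z ∈ 𝒵, Finset.univ \ Z ⊆ C

/-! ### Protocols, environments, adversaries

Every entity is a probabilistic reactive machine without any bound on its computing power.
Channels carry bit strings. The definitions concern one session. -/

/-- An `n`-party protocol. When party `i` is activated by the environment, possibly with an input, it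
also receives the messages that its incoming channels release at that moment (with the identity of
their senders); it then sends messages and possibly hands an output to the environment. -/
structure Protocol (n : ℕ) (In Out : Type) where
  State : Type
  init : Fin n → State
  step : Fin n → State → Option In → List (Fin n × List Bool) →
    PMF (State × List (Fin n × List Bool) × Option Out)

/-- What the environment can do: activate a party, possibly with an input (an activation is also the
party's request for messages, or for output from the functionality), or send the adversary a message. -/
inductive EnvAction (n : ℕ) (In : Type) where
  | activate (i : Fin n) (x : Option In)
  | toAdv (msg : List Bool)

/-- What the environment gets back: a message of the adversary and, if a party was activated, the
output that this party produced, if any. -/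
structure Obs (Out : Type) where
  advMsg : List Bool
  out : Option Out

/-- An environment: it either acts or stops with a bit as its output. -/
structure Environment (n : ℕ) (In Out : Type) where
  State : Type
  init : State
  step : State → Option (Obs Out) → PMF (State × (EnvAction n In ⊕ Bool))

/-- A message on the channel from `src` to `dst`; `delay` is the number of further activations of
`dst` during which the channel still withholds it; `pending` says that it is not yet delivered. -/
structure Packet (n : ℕ) where
  src : Fin n
  dst : Fin n
  body : List Bool
  delay : ℕ
  pending : Bool

/-- What the adversary sees of a message: of a message between honest parties only its length. -/
structure PacketView (n : ℕ) where
  src : Fin n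
  dst : Fin n
  body : Option (List Bool)
  length : ℕ
  delay : ℕ
  pending : Bool

def Packet.view {n : ℕ} (Z : Finset (Fin n)) (p : Packet n) : PacketView n where
  src := p.src
  dst := p.dst
  body := if p.src ∈ Z ∨ p.dst ∈ Z then some p.body else none
  length := p.body.length
  delay := p.delay
  pending := p.pending

/-- Why the adversary is activated: a message of the environment, an honest party that has been
activated and is about to be served by its channels, or an activation of a corrupt party. -/
inductive AdvEvent (n : ℕ) (In : Type) where
  | env (msg : List Bool)
  | activated (i : Fin n)
  | corruptInput (i : Fin n) (x : Option In)

/-- Commands of the adversary: delay the `k`-th message by `T` more activations of its recipient, or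
send a message on behalf of a corrupt party. -/
inductive NetCmd (n : ℕ) where
  | delay (k T : ℕ)
  | inject (src dst : Fin n) (body : List Bool)

/-- A real-world adversary; it is started with the set of corrupt parties and an auxiliary input. Its
last output is its message to the environment. -/
structure Adversary (n : ℕ) (In : Type) where
  State : Type
  init : Finset (Fin n) → List Bool → State
  step : State → AdvEvent n In → List (PacketView n) → PMF (State × List (NetCmd n) × List Bool)

/-! ### Executions -/

/-- The output of the environment within its first `k` activations (`none`: it has not stopped), when
it interacts with a world whose reaction to the actions of the environment is `stepW`. -/
noncomputable def exec {n : ℕ} {In Out W : Type} (E : Environment n In Out)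
    (stepW : W → EnvAction n In → PMF (W × Obs Out)) :
    ℕ → E.State → Option (Obs Out) → W → PMF (Option Bool)
  | 0, _, _, _ => PMF.pure none
  | k + 1, e, o, w => (E.step e o).bind fun r =>
      match r with
      | (_, Sum.inr b) => PMF.pure (some b)
      | (e', Sum.inl a) => (stepW w a).bind fun q => exec E stepW k e' (some q.2) q.1

/-- `w` is a possible infinite evolution of a world from `w₀` under the environment actions `a`. -/
def IsRun {n : ℕ} {In Out W : Type} (stepW : W → EnvAction n In → PMF (W × Obs Out))
    (w₀ : W) (a : ℕ → EnvAction n In) (w : ℕ → W) : Prop :=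
  w 0 = w₀ ∧ ∀ k, ∃ o, (w (k + 1), o) ∈ (stepW (w k) (a k)).support

/-- Every honest party is activated infinitely often. -/
def IsFair {n : ℕ} {In : Type} (Z : Finset (Fin n)) (a : ℕ → EnvAction n In) : Prop :=
  ∀ i ∉ Z, ∃ᶠ k in Filter.atTop, ∃ x, a k = EnvAction.activate i x

/-! ### The asynchronous real world -/

structure RealWorld {n : ℕ} {In Out : Type} (Pr : Protocol n In Out) (A : Adversary n In) where
  adv : A.State
  party : Fin n → Pr.State
  net : List (Packet n)

def RealWorld.start {n : ℕ} {In Out : Type} (Pr : Protocol n In Out) (A : Adversary n In)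
    (Z : Finset (Fin n)) (z : List Bool) : RealWorld Pr A :=
  ⟨A.init Z z, Pr.init, []⟩

def NetCmd.apply {n : ℕ} (Z : Finset (Fin n)) (net : List (Packet n)) : NetCmd n → List (Packet n)
  | .delay k T => net.modify k fun p => { p with delay := p.delay + T }
  | .inject s d b => if s ∈ Z then net ++ [⟨s, d, b, 0, true⟩] else net

/-- The messages that the channels release to `i` at its present activation. -/
def released {n : ℕ} (i : Fin n) (net : List (Packet n)) : List (Fin n × List Bool) :=
  (net.filter fun p => decide (p.dst = i) && p.pending && decide (p.delay = 0)).map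
    fun p => (p.src, p.body)

/-- The channels after they have served an activation of `i`. -/
def afterFetch {n : ℕ} (i : Fin n) (net : List (Packet n)) : List (Packet n) :=
  net.map fun p =>
    if p.dst = i ∧ p.pending = true then
      if p.delay = 0 then { p with pending := false } else { p with delay := p.delay - 1 }
    else p

/-- The real world with corrupt set `Z` reacts to an action of the environment. If an honest party `i`
is activated, the adversary is told so first and may issue commands; then `i` receives the messages
that are due, computes and sends; then control returns to the environment. -/
noncomputable def realStep {n : ℕ} {In Out : Type} (Pr : Protocol n In Out) (A : Adversary n In)
    (Z : Finset (Fin n)) (w : RealWorld Pr A) :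
    EnvAction n In → PMF (RealWorld Pr A × Obs Out)
  | .toAdv msg =>
      (A.step w.adv (.env msg) (w.net.map (Packet.view Z))).bind fun r =>
        PMF.pure (⟨r.1, w.party, r.2.1.foldl (NetCmd.apply Z) w.net⟩, ⟨r.2.2, none⟩)
  | .activate i x =>
      if i ∈ Z then
        (A.step w.adv (.corruptInput i x) (w.net.map (Packet.view Z))).bind fun r =>
          PMF.pure (⟨r.1, w.party, r.2.1.foldl (NetCmd.apply Z) w.net⟩, ⟨r.2.2, none⟩)
      else
        (A.step w.adv (.activated i) (w.net.map (Packet.view Z))).bind fun r =>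
          let net := r.2.1.foldl (NetCmd.apply Z) w.net
          (Pr.step i (w.party i) x (released i net)).bind fun q =>
            PMF.pure
              (⟨r.1, Function.update w.party i q.1,
                afterFetch i net ++ q.2.1.map fun s => ⟨i, s.1, s.2, 0, true⟩⟩,
               ⟨r.2.2, q.2.2⟩)

/-- The distribution of the output of the environment in the real world. -/
noncomputable def REAL {n : ℕ} {In Out : Type} (Pr : Protocol n In Out) (A : Adversary n In)
    (z : List Bool) (Z : Finset (Fin n)) (E : Environment n In Out) (k : ℕ) : PMF (Option Bool) :=
  exec E (realStep Pr A Z) k E.init none (RealWorld.start Pr A Z z)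

/-- The adversary delays messages only finitely: if every honest party is activated again and again,
every message from an honest party to an honest party is eventually delivered. -/
def Adversary.EventualDelivery {n : ℕ} {In Out : Type} (𝒵 : Finset (Finset (Fin n)))
    (Pr : Protocol n In Out) (A : Adversary n In) : Prop :=
  ∀ (Z : Finset (Fin n)), Corruptible 𝒵 Z → ∀ (z : List Bool) (a : ℕ → EnvAction n In)
    (w : ℕ → RealWorld Pr A),
    IsRun (realStep Pr A Z) (RealWorld.start Pr A Z z) a w → IsFair Z a →
    ∀ (k m : ℕ) (p : Packet n), (w k).net[m]? = some p → p.src ∉ Z → p.dst ∉ Z →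
      ∃ k' p', (w k').net[m]? = some p' ∧ p'.pending = false

/-- The number of bits that the honest parties have sent so far. -/
def RealWorld.honestBits {n : ℕ} {In Out : Type} {Pr : Protocol n In Out} {A : Adversary n In}
    (Z : Finset (Fin n)) (w : RealWorld Pr A) : ℕ :=
  ((w.net.filter fun p => decide (p.src ∉ Z)).map fun p => p.body.length).sum

/-- In every execution the honest parties send at most `B` bits in total, whatever the environment
and the adversary do. -/
def Protocol.CommunicationAtMost {n : ℕ} {In Out : Type} (𝒵 : Finset (Finset (Fin n)))
    (Pr : Protocol n In Out) (B : ℕ) : Prop :=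
  ∀ (A : Adversary n In) (Z : Finset (Fin n)), Corruptible 𝒵 Z → ∀ (z : List Bool)
    (a : ℕ → EnvAction n In) (w : ℕ → RealWorld Pr A),
    IsRun (realStep Pr A Z) (RealWorld.start Pr A Z z) a w → ∀ k, (w k).honestBits Z ≤ B

/-! ### The asynchronous ideal world -/

/-- An ideal functionality with request-based delayed outputs. `input` handles the input of an honest
party (and possibly sends the simulator a message), `adv` a message of the simulator; both know the
set of corrupt parties. `output s i` is the output that is prepared for party `i`. -/
structure Functionality (n : ℕ) (In Out Leak AdvMsg : Type) where
  State : Type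
  init : State
  input : Finset (Fin n) → Fin n → In → State → State × Option Leak
  adv : Finset (Fin n) → AdvMsg → State → State
  output : State → Fin n → Option Out

/-- Why the simulator is activated: a message of the environment, an honest dummy party has been
activated (with the message, if any, that the functionality sends because of its input), or an
activation of a corrupt party. -/
inductive SimEvent (n : ℕ) (In Leak : Type) where
  | env (msg : List Bool)
  | activated (i : Fin n) (leak : Option Leak)
  | corruptInput (i : Fin n) (x : Option In)

/-- Commands of the simulator to the functionality: ignore the next `T` further requests that party
`i` makes while its output is prepared, or a message. -/
inductive FCmd (n : ℕ) (AdvMsg : Type) where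
  | delay (i : Fin n) (T : ℕ)
  | msg (m : AdvMsg)

/-- An ideal-world adversary. Its last output is its message to the environment. -/
structure Simulator (n : ℕ) (In Leak AdvMsg : Type) where
  State : Type
  init : Finset (Fin n) → List Bool → State
  step : State → SimEvent n In Leak → PMF (State × List (FCmd n AdvMsg) × List Bool)

/-- `delay i` is the number of further requests of `i` that are going to be ignored; `served` is the
set of parties that have obtained their output. -/
structure IdealWorld {n : ℕ} {In Out Leak AdvMsg : Type} (F : Functionality n In Out Leak AdvMsg)
    (S : Simulator n In Leak AdvMsg) where
  sim : S.State
  func : F.State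
  delay : Fin n → ℕ
  served : Finset (Fin n)

def IdealWorld.start {n : ℕ} {In Out Leak AdvMsg : Type} (F : Functionality n In Out Leak AdvMsg)
    (S : Simulator n In Leak AdvMsg) (Z : Finset (Fin n)) (z : List Bool) : IdealWorld F S :=
  ⟨S.init Z z, F.init, fun _ => 0, ∅⟩

def FCmd.apply {n : ℕ} {In Out Leak AdvMsg : Type} (F : Functionality n In Out Leak AdvMsg)
    (Z : Finset (Fin n)) (s : F.State × (Fin n → ℕ)) : FCmd n AdvMsg → F.State × (Fin n → ℕ)
  | .delay i T => (s.1, Function.update s.2 i (s.2 i + T))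
  | .msg m => (F.adv Z m s.1, s.2)

/-- The functionality answers the request of the honest party `i`. -/
def IdealWorld.serve {n : ℕ} {In Out Leak AdvMsg : Type} {F : Functionality n In Out Leak AdvMsg}
    {S : Simulator n In Leak AdvMsg} (w : IdealWorld F S) (i : Fin n) :
    IdealWorld F S × Option Out :=
  match F.output w.func i with
  | none => (w, none)
  | some y =>
      if i ∈ w.served then (w, none)
      else if w.delay i = 0 then ({ w with served := insert i w.served }, some y)
      else ({ w with delay := Function.update w.delay i (w.delay i - 1) }, none)

/-- The ideal world with corrupt set `Z` reacts to an action of the environment. An honest dummy party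
that is activated forwards its input, if any, to the functionality and requests its output; the
simulator is told about the activation and may issue commands; then the request is answered. -/
noncomputable def idealStep {n : ℕ} {In Out Leak AdvMsg : Type}
    (F : Functionality n In Out Leak AdvMsg) (S : Simulator n In Leak AdvMsg)
    (Z : Finset (Fin n)) (w : IdealWorld F S) :
    EnvAction n In → PMF (IdealWorld F S × Obs Out)
  | .toAdv msg =>
      (S.step w.sim (.env msg)).bind fun r =>
        let f := r.2.1.foldl (FCmd.apply F Z) (w.func, w.delay)
        PMF.pure (⟨r.1, f.1, f.2, w.served⟩, ⟨r.2.2, none⟩)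
  | .activate i x =>
      if i ∈ Z then
        (S.step w.sim (.corruptInput i x)).bind fun r =>
          let f := r.2.1.foldl (FCmd.apply F Z) (w.func, w.delay)
          PMF.pure (⟨r.1, f.1, f.2, w.served⟩, ⟨r.2.2, none⟩)
      else
        let g : F.State × Option Leak :=
          match x with
          | none => (w.func, none)
          | some v => F.input Z i v w.func
        (S.step w.sim (.activated i g.2)).bind fun r =>
          let f := r.2.1.foldl (FCmd.apply F Z) (g.1, w.delay)
          let u := (⟨r.1, f.1, f.2, w.served⟩ : IdealWorld F S).serve i
          PMF.pure (u.1, ⟨r.2.2, u.2⟩)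

/-- The distribution of the output of the environment in the ideal world. -/
noncomputable def IDEAL {n : ℕ} {In Out Leak AdvMsg : Type}
    (F : Functionality n In Out Leak AdvMsg) (S : Simulator n In Leak AdvMsg)
    (z : List Bool) (Z : Finset (Fin n)) (E : Environment n In Out) (k : ℕ) : PMF (Option Bool) :=
  exec E (idealStep F S Z) k E.init none (IdealWorld.start F S Z z)

/-- The simulator delays outputs only finitely: if every honest party is activated again and again,
every honest party for which an output is prepared eventually obtains it. -/
def Simulator.EventualDelivery {n : ℕ} {In Out Leak AdvMsg : Type} (𝒵 : Finset (Finset (Fin n)))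
    (F : Functionality n In Out Leak AdvMsg) (S : Simulator n In Leak AdvMsg) : Prop :=
  ∀ (Z : Finset (Fin n)), Corruptible 𝒵 Z → ∀ (z : List Bool) (a : ℕ → EnvAction n In)
    (w : ℕ → IdealWorld F S),
    IsRun (idealStep F S Z) (IdealWorld.start F S Z z) a w → IsFair Z a →
    ∀ (k : ℕ), ∀ i ∉ Z, F.output (w k).func i ≠ none → ∃ k', i ∈ (w k').served

/-! ### Running time of the simulator -/

/-- A finite-state control around one copy of the real-world execution: `input` determines the input
with which the virtual honest party is activated, `react` the commands to the functionality. -/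
structure SimControl (n : ℕ) (In Out Leak AdvMsg : Type) where
  Mem : Type
  finite : Finite Mem
  init : Finset (Fin n) → Mem
  input : Mem → Fin n → Option Leak → Option In
  react : Mem → Fin n → Option Leak → Option Out → Mem × List (FCmd n AdvMsg)

/-- The simulator with control `C` that runs `A` and virtual honest parties of `Pr`. At each of its
activations it advances the virtual execution by exactly one event, and it forwards the messages
between the environment and `A` unchanged. -/
noncomputable def SimControl.toSimulator {n : ℕ} {In Out Leak AdvMsg : Type}
    (C : SimControl n In Out Leak AdvMsg) (Pr : Protocol n In Out) (A : Adversary n In) :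
    Simulator n In Leak AdvMsg where
  State := RealWorld Pr A × Finset (Fin n) × C.Mem
  init Z z := (RealWorld.start Pr A Z z, Z, C.init Z)
  step s
    | .env msg => (realStep Pr A s.2.1 s.1 (.toAdv msg)).bind fun r =>
        PMF.pure ((r.1, s.2), [], r.2.advMsg)
    | .corruptInput i x => (realStep Pr A s.2.1 s.1 (.activate i x)).bind fun r =>
        PMF.pure ((r.1, s.2), [], r.2.advMsg)
    | .activated i l =>
        (realStep Pr A s.2.1 s.1 (.activate i (C.input s.2.2 i l))).bind fun r =>
          let c := C.react s.2.2 i l r.2.out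
          PMF.pure ((r.1, s.2.1, c.1), c.2, r.2.advMsg)

/-- `S` runs in time polynomial (even linear) in the running time of `A`: at each activation it
activates `A` exactly once and at most one party of `Pr` once, and apart from the bookkeeping of the
virtual channels it only has a finite control. -/
def Simulator.RunsInTimeOf {n : ℕ} {In Out Leak AdvMsg : Type} (Pr : Protocol n In Out)
    (A : Adversary n In) (S : Simulator n In Leak AdvMsg) : Prop :=
  ∃ C : SimControl n In Out Leak AdvMsg, S = C.toSimulator Pr A

/-! ### Perfect UC security -/

/-- `Pr` UC-securely realizes `F` with perfect security against static corruption of any set in the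
adversary structure `𝒵`: for every adversary there is a simulator, whose running time is bounded in
terms of that of the adversary and which delays only finitely if the adversary does, such that no
environment distinguishes the two worlds: its output has the same distribution in both. -/
def UCSecurelyRealizes {n : ℕ} {In Out Leak AdvMsg : Type} (𝒵 : Finset (Finset (Fin n)))
    (Pr : Protocol n In Out) (F : Functionality n In Out Leak AdvMsg) : Prop :=
  ∀ A : Adversary n In, ∃ S : Simulator n In Leak AdvMsg,
    S.RunsInTimeOf Pr A ∧
    (A.EventualDelivery 𝒵 Pr → S.EventualDelivery 𝒵 F) ∧
    ∀ (Z : Finset (Fin n)), Corruptible 𝒵 Z → ∀ (z : List Bool) (E : Environment n In Out) (k : ℕ),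
      REAL Pr A z Z E k = IDEAL F S z Z E k

/-! ### The functionality for asynchronous reliable broadcast -/

/-- The state is the message of the sender, once it is there. An honest sender supplies it itself, and
the functionality then passes it on to the simulator; for a corrupt sender the simulator supplies it.
The message is the output that is prepared for every party. -/
def FAcast {n : ℕ} (ℓ : ℕ) (sender : Fin n) :
    Functionality n (List.Vector Bool ℓ) (List.Vector Bool ℓ) (List.Vector Bool ℓ)
      (List.Vector Bool ℓ) where
  State := Option (List.Vector Bool ℓ)
  init := none
  input Z i m s := if i = sender ∧ i ∉ Z ∧ s = none then (some m, some m) else (s, none)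
  adv Z m s := if sender ∈ Z ∧ s = none then some m else s
  output s _ := s

/-! ### The echo/ready protocol -/

inductive Kind where
  | inp
  | echo
  | ready

/-- A message consists of a tag of two bits and `ℓ` bits of content. -/
def encode {ℓ : ℕ} (t : Kind) (m : List.Vector Bool ℓ) : List Bool :=
  match t with
  | .inp => false :: false :: m.toList
  | .echo => false :: true :: m.toList
  | .ready => true :: false :: m.toList

/-- Ill-formed strings are discarded. -/
def decode (ℓ : ℕ) : List Bool → Option (Kind × List.Vector Bool ℓ)
  | b :: c :: l =>
      if h : l.length = ℓ then
        match b, c with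
        | false, false => some (.inp, ⟨l, h⟩)
        | false, true => some (.echo, ⟨l, h⟩)
        | true, false => some (.ready, ⟨l, h⟩)
        | true, true => none
      else none
  | _ => none

/-- `started`, `echoed`, `readied`: the party has sent its `inp`, `echo`, `ready` message;
`finished`: it has produced its output; `echoes`, `readies`: the `echo` and `ready` messages that it
has received, with their senders. -/
structure AcastState (n ℓ : ℕ) where
  started : Bool
  echoed : Bool
  readied : Bool
  finished : Bool
  echoes : Finset (Fin n × List.Vector Bool ℓ)
  readies : Finset (Fin n × List.Vector Bool ℓ)

def AcastState.init (n ℓ : ℕ) : AcastState n ℓ := ⟨false, false, false, false, ∅, ∅⟩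

/-- The parties from which a message with content `m` has been received. -/
def sendersOf {n ℓ : ℕ} (R : Finset (Fin n × List.Vector Bool ℓ)) (m : List.Vector Bool ℓ) :
    Finset (Fin n) :=
  Finset.univ.filter fun j => (j, m) ∈ R

def sendAll {n ℓ : ℕ} (t : Kind) (m : List.Vector Bool ℓ) : List (Fin n × List Bool) :=
  (List.finRange n).map fun j => (j, encode t m)

/-- The state of a party during an activation, the messages it has sent in this activation so far, and
its output in this activation. -/
structure AcastLocal (n ℓ : ℕ) where
  st : AcastState n ℓ
  sent : List (Fin n × List Bool)
  out : Option (List.Vector Bool ℓ)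

/-- The sender distributes its input. -/
def acastInput {n ℓ : ℕ} (sender i : Fin n) (c : AcastLocal n ℓ) :
    Option (List.Vector Bool ℓ) → AcastLocal n ℓ
  | none => c
  | some m =>
      if i = sender ∧ c.st.started = false then
        { c with st := { c.st with started := true }, sent := c.sent ++ sendAll .inp m }
      else c

/-- Send `ready` for `m`, unless a `ready` message has been sent before. -/
def sendReady {n ℓ : ℕ} (c : AcastLocal n ℓ) (m : List.Vector Bool ℓ) : AcastLocal n ℓ :=
  if c.st.readied = false then
    { c with st := { c.st with readied := true }, sent := c.sent ++ sendAll .ready m }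
  else c

/-- Output `m`, unless an output has been produced before. -/
def giveOutput {n ℓ : ℕ} (c : AcastLocal n ℓ) (m : List.Vector Bool ℓ) : AcastLocal n ℓ :=
  if c.st.finished = false then
    { c with st := { c.st with finished := true }, out := some m }
  else c

/-- The reaction of a party to the string `r.2` received from party `r.1`. -/
def acastReceive {n ℓ : ℕ} (𝒵 : Finset (Finset (Fin n))) (sender : Fin n) (c : AcastLocal n ℓ)
    (r : Fin n × List Bool) : AcastLocal n ℓ :=
  match decode ℓ r.2 with
  | none => c
  | some (.inp, m) =>
      if r.1 = sender ∧ c.st.echoed = false then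
        { c with st := { c.st with echoed := true }, sent := c.sent ++ sendAll .echo m }
      else c
  | some (.echo, m) =>
      let c₁ := { c with st := { c.st with echoes := insert (r.1, m) c.st.echoes } }
      if IsQuorum 𝒵 (sendersOf c₁.st.echoes m) then sendReady c₁ m else c₁
  | some (.ready, m) =>
      let c₁ := { c with st := { c.st with readies := insert (r.1, m) c.st.readies } }
      let c₂ := if ¬ Corruptible 𝒵 (sendersOf c₁.st.readies m) then sendReady c₁ m else c₁
      if IsQuorum 𝒵 (sendersOf c₂.st.readies m) then giveOutput c₂ m else c₂

/-- One activation of party `i`. -/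
def acastActivation {n ℓ : ℕ} (𝒵 : Finset (Finset (Fin n))) (sender i : Fin n) (st : AcastState n ℓ)
    (x : Option (List.Vector Bool ℓ)) (recv : List (Fin n × List Bool)) : AcastLocal n ℓ :=
  recv.foldl (acastReceive 𝒵 sender) (acastInput sender i ⟨st, [], none⟩ x)

/-- The protocol; it is deterministic. -/
noncomputable def AcastProtocol {n : ℕ} (𝒵 : Finset (Finset (Fin n))) (ℓ : ℕ) (sender : Fin n) :
    Protocol n (List.Vector Bool ℓ) (List.Vector Bool ℓ) where
  State := AcastState n ℓ
  init _ := AcastState.init n ℓ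
  step i st x recv :=
    let c := acastActivation 𝒵 sender i st x recv
    PMF.pure (c.st, c.sent, c.out)

end AsyncUC

namespace AsyncUC

/-!
The protocol is deterministic and has no secrets: an honest sender's message is leaked to the
simulator, which can therefore run the real execution itself. Real and ideal world are then coupled
step by step, provided the functionality answers with what the virtual parties output.

*Consistency.* By `Q 3`, any two quorums (complements of sets of `𝒵`) share a party outside the
corrupt set. Since an honest party echoes only once, no two messages both collect an echo quorum;
the first honest party to send `ready` for a message has seen one, so all `ready` messages of
honest parties carry the same message, which is the sender's if the sender is honest. A set of
parties that is not corruptible contains an honest one, hence so does a quorum, and every output is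
this message. For a corrupt sender, the simulator inputs it when a virtual party first outputs.

*Liveness.* The honest members of a `ready` quorum still form a set that is not corruptible. So,
once one honest party has output, their messages make every honest party send `ready`, and the set
of honest parties contains a quorum.

*Communication.* Each honest party sends at most one `inp`, one `echo` and one `ready` message of
`ℓ + 2` bits to each of the `n` parties.
-/

variable {n ℓ : ℕ}

section Simulation

theorem pmf_bind_congr {α β : Type*} {p : PMF α} {f g : α → PMF β}
    (h : ∀ a ∈ p.support, f a = g a) : p.bind f = p.bind g := by
  rw [← PMF.bindOnSupport_eq_bind, ← PMF.bindOnSupport_eq_bind]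
  exact congrArg _ (funext₂ h)

variable {In Out V W : Type}

/-- A deterministic coupling of two worlds: as long as they are related by `R`, the reaction of the
second is a function of the reaction of the first that keeps `R` and the observation. -/
def IsSimulation (stepV : V → EnvAction n In → PMF (V × Obs Out))
    (stepW : W → EnvAction n In → PMF (W × Obs Out)) (R : V → W → Prop) : Prop :=
  ∀ ⦃v w⦄, R v w → ∀ a, ∃ f : V × Obs Out → W × Obs Out, stepW w a = (stepV v a).map f ∧
    ∀ q ∈ (stepV v a).support, (f q).2 = q.2 ∧ R q.1 (f q).1

variable {stepV : V → EnvAction n In → PMF (V × Obs Out)}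
  {stepW : W → EnvAction n In → PMF (W × Obs Out)} {R : V → W → Prop}

theorem IsSimulation.exec_eq (hR : IsSimulation stepV stepW R) (E : Environment n In Out) (k : ℕ)
    (e : E.State) (o : Option (Obs Out)) {v : V} {w : W} (hvw : R v w) :
    exec E stepV k e o v = exec E stepW k e o w := by
  induction k generalizing e o v w with
  | zero => rfl
  | succ k ih =>
    refine congrArg (E.step e o).bind (funext ?_)
    rintro ⟨e', a | b⟩
    · obtain ⟨f, hf, hfR⟩ := hR hvw a
      simp only [hf, PMF.bind_map]
      refine pmf_bind_congr fun q hq => ?_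
      rw [Function.comp_apply, (hfR q hq).1, ih _ _ (hfR q hq).2]
    · rfl

theorem IsSimulation.exists_isRun (hR : IsSimulation stepV stepW R) {v₀ : V} {w₀ : W}
    (h₀ : R v₀ w₀) {a : ℕ → EnvAction n In} {w : ℕ → W} (hw : IsRun stepW w₀ a w) :
    ∃ v, IsRun stepV v₀ a v ∧ ∀ k, R (v k) (w k) := by
  have lift_step (k : ℕ) (v : {v // R v (w k)}) :
      ∃ v' : {v // R v (w (k + 1))}, ∃ o, (v'.1, o) ∈ (stepV v.1 (a k)).support := by
    obtain ⟨f, hf, hfR⟩ := hR v.2 (a k)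
    obtain ⟨o, ho⟩ := hw.2 k
    obtain ⟨q, hq, hfq⟩ := (PMF.mem_support_map_iff _ _ _).1 (hf ▸ ho)
    have hq' := (hfR q hq).2
    rw [hfq] at hq'
    exact ⟨⟨q.1, hq'⟩, q.2, hq⟩
  choose next hnext using lift_step
  let v (k : ℕ) : {v // R v (w k)} := Nat.rec ⟨v₀, hw.1 ▸ h₀⟩ next k
  exact ⟨fun k => (v k).1, ⟨rfl, fun k => hnext k (v k)⟩, fun k => (v k).2⟩

end Simulation

section RealWorld

/-- The source, destination and content of every message sent so far, in the order of sending. -/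
def traffic (net : List (Packet n)) : List (Fin n × Fin n × List Bool) :=
  net.map fun p => (p.src, p.dst, p.body)

/-- The message `b` from `j` to `d` has been delivered. -/
def Delivered (net : List (Packet n)) (j d : Fin n) (b : List Bool) : Prop :=
  ∃ p ∈ net, p.src = j ∧ p.dst = d ∧ p.body = b ∧ p.pending = false

/-- The messages of `i`, listed in `l` with their destinations, as they enter the channels. -/
def outgoing (i : Fin n) (l : List (Fin n × List Bool)) : List (Packet n) :=
  l.map fun s => ⟨i, s.1, s.2, 0, true⟩

/-- The traffic that arises when `i` sends the messages listed in `l`. -/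
def sentBy (i : Fin n) (l : List (Fin n × List Bool)) : List (Fin n × Fin n × List Bool) :=
  l.map fun s => (i, s.1, s.2)

theorem traffic_append (net net' : List (Packet n)) :
    traffic (net ++ net') = traffic net ++ traffic net' :=
  List.map_append

theorem traffic_outgoing (i : Fin n) (l : List (Fin n × List Bool)) :
    traffic (outgoing i l) = sentBy i l := by
  simp [traffic, outgoing, sentBy]

theorem mem_sentBy {i j d : Fin n} {b : List Bool} {l : List (Fin n × List Bool)} :
    (j, d, b) ∈ sentBy i l ↔ j = i ∧ (d, b) ∈ l := by
  simp [sentBy, and_comm, eq_comm]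

theorem sentBy_append (i : Fin n) (l l' : List (Fin n × List Bool)) :
    sentBy i (l ++ l') = sentBy i l ++ sentBy i l' :=
  List.map_append

theorem map_modify_of_comp_eq {α β : Type*} (f : α → α) (g : α → β) (h : ∀ a, g (f a) = g a)
    (l : List α) (k : ℕ) : (l.modify k f).map g = l.map g := by
  refine List.ext_getElem? fun j => ?_
  by_cases hk : k = j <;> simp [hk, Function.comp_def, h]

theorem NetCmd.exists_traffic_apply (Z : Finset (Fin n)) (net : List (Packet n))
    (cmd : NetCmd n) : ∃ L, traffic (cmd.apply Z net) = traffic net ++ L ∧ ∀ x ∈ L, x.1 ∈ Z := by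
  rcases cmd with ⟨k, T⟩ | ⟨s, d, b⟩
  · refine ⟨[], ?_, by simp⟩
    rw [List.append_nil]
    exact map_modify_of_comp_eq _ _ (by exact fun _ => rfl) net k
  · by_cases hs : s ∈ Z
    · exact ⟨[(s, d, b)], by simp [NetCmd.apply, hs, traffic], by simpa using hs⟩
    · exact ⟨[], by simp [NetCmd.apply, hs], by simp⟩

theorem exists_traffic_foldl_apply (Z : Finset (Fin n)) (cmds : List (NetCmd n))
    (net : List (Packet n)) :
    ∃ L, traffic (cmds.foldl (NetCmd.apply Z) net) = traffic net ++ L ∧ ∀ x ∈ L, x.1 ∈ Z := by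
  induction cmds generalizing net with
  | nil => exact ⟨[], (List.append_nil _).symm, by simp⟩
  | cons cmd _ ih =>
    obtain ⟨L, hL, hLZ⟩ := cmd.exists_traffic_apply Z net
    obtain ⟨L', hL', hLZ'⟩ := ih (cmd.apply Z net)
    refine ⟨L ++ L', by rw [List.foldl_cons, hL', hL, List.append_assoc], fun x hx => ?_⟩
    exact (List.mem_append.1 hx).elim (hLZ x) (hLZ' x)

theorem delivered_iff_mem_map {net : List (Packet n)} {j d : Fin n} {b : List Bool} :
    Delivered net j d b ↔
      (j, d, b, false) ∈ net.map fun p => (p.src, p.dst, p.body, p.pending) := by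
  simp [Delivered]

theorem NetCmd.delivered_of_apply {Z : Finset (Fin n)} {net : List (Packet n)} {cmd : NetCmd n}
    {j d : Fin n} {b : List Bool} (h : Delivered (cmd.apply Z net) j d b) :
    Delivered net j d b := by
  rw [delivered_iff_mem_map] at h ⊢
  rcases cmd with ⟨k, T⟩ | ⟨s, d', b'⟩
  · rwa [NetCmd.apply, map_modify_of_comp_eq _ _ (by exact fun _ => rfl)] at h
  · by_cases hs : s ∈ Z <;> simpa [NetCmd.apply, hs] using h

theorem traffic_afterFetch (i : Fin n) (net : List (Packet n)) :
    traffic (afterFetch i net) = traffic net := by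
  rw [traffic, afterFetch, List.map_map]
  refine List.map_congr_left fun p _ => ?_
  rw [Function.comp_apply]
  split_ifs <;> rfl

theorem delivered_of_afterFetch_append {i j d : Fin n} {b : List Bool} {net : List (Packet n)}
    {l : List (Fin n × List Bool)} (h : Delivered (afterFetch i net ++ outgoing i l) j d b) :
    Delivered net j d b ∨ d = i ∧ (j, b) ∈ released i net := by
  obtain ⟨p', hp', rfl, rfl, rfl, hdelivered⟩ := h
  rcases List.mem_append.1 hp' with hp' | hp'
  · obtain ⟨p, hp, rfl⟩ := List.mem_map.1 hp'
    split_ifs at hdelivered ⊢ with hdst hdue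
    · exact .inr ⟨hdst.1, List.mem_map.2 ⟨p, List.mem_filter.2 ⟨hp, by simp [hdst, hdue]⟩, rfl⟩⟩
    · exact absurd hdst.2 (by simpa using hdelivered)
    · exact .inl ⟨p, hp, rfl, rfl, rfl, hdelivered⟩
  · obtain ⟨s, -, rfl⟩ := List.mem_map.1 hp'
    exact absurd hdelivered (by simp)

theorem mem_traffic_of_mem_released {i j : Fin n} {b : List Bool} {net : List (Packet n)}
    (h : (j, b) ∈ released i net) : (j, i, b) ∈ traffic net := by
  obtain ⟨p, hp, hpj⟩ := List.mem_map.1 h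
  obtain ⟨rfl, rfl⟩ := Prod.mk.inj hpj
  obtain ⟨hp, hdue⟩ := List.mem_filter.1 hp
  have hdst : p.dst = i := by
    simp only [Bool.and_eq_true, decide_eq_true_eq] at hdue
    exact hdue.1.1
  exact List.mem_map.2 ⟨p, hp, by rw [hdst]⟩

variable {In Out : Type} {Pr : Protocol n In Out} {A : Adversary n In} {Z : Finset (Fin n)}

/-- The action `a` does not activate an honest party. -/
def EnvAction.IsPassive (Z : Finset (Fin n)) (a : EnvAction n In) : Prop :=
  ∀ i x, a = .activate i x → i ∈ Z

theorem exists_of_mem_support_realStep_passive {w : RealWorld Pr A} {a : EnvAction n In}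
    (ha : a.IsPassive Z) {q : RealWorld Pr A × Obs Out} (hq : q ∈ (realStep Pr A Z w a).support) :
    q.1.party = w.party ∧ q.2.out = none ∧
      ∃ cmds : List (NetCmd n), q.1.net = cmds.foldl (NetCmd.apply Z) w.net := by
  rcases a with ⟨i, x⟩ | msg
  · simp only [realStep, ha i x rfl, if_true, PMF.mem_support_bind_iff,
      PMF.mem_support_pure_iff] at hq
    obtain ⟨r, -, rfl⟩ := hq
    exact ⟨rfl, rfl, r.2.1, rfl⟩
  · simp only [realStep, PMF.mem_support_bind_iff, PMF.mem_support_pure_iff] at hq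
    obtain ⟨r, -, rfl⟩ := hq
    exact ⟨rfl, rfl, r.2.1, rfl⟩

theorem exists_of_mem_support_realStep_activate {w : RealWorld Pr A} {i : Fin n} (hi : i ∉ Z)
    {x : Option In} {q : RealWorld Pr A × Obs Out}
    (hq : q ∈ (realStep Pr A Z w (.activate i x)).support) :
    ∃ cmds : List (NetCmd n), ∃ net, net = cmds.foldl (NetCmd.apply Z) w.net ∧
      ∃ r ∈ (Pr.step i (w.party i) x (released i net)).support,
        q.1.party = Function.update w.party i r.1 ∧
        q.1.net = afterFetch i net ++ outgoing i r.2.1 ∧ q.2.out = r.2.2 := by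
  simp only [realStep, hi, if_false, PMF.mem_support_bind_iff, PMF.mem_support_pure_iff] at hq
  obtain ⟨c, -, r, hr, rfl⟩ := hq
  exact ⟨c.2.1, _, rfl, r, hr, rfl, rfl, rfl⟩

/-- The property `I` of the channels and the states of the parties is kept by every command of the
adversary and by every activation of an honest party. -/
structure Protocol.Preserves (Pr : Protocol n In Out) (Z : Finset (Fin n))
    (I : List (Packet n) → (Fin n → Pr.State) → Prop) : Prop where
  command : ∀ {net party}, I net party → ∀ cmd : NetCmd n, I (cmd.apply Z net) party
  activation : ∀ {net party}, I net party → ∀ i ∉ Z, ∀ x,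
    ∀ r ∈ (Pr.step i (party i) x (released i net)).support,
      I (afterFetch i net ++ outgoing i r.2.1) (Function.update party i r.1)

namespace Protocol.Preserves

variable {I : List (Packet n) → (Fin n → Pr.State) → Prop}

theorem commands (hI : Pr.Preserves Z I) {net : List (Packet n)} {party : Fin n → Pr.State}
    (h : I net party) (cmds : List (NetCmd n)) : I (cmds.foldl (NetCmd.apply Z) net) party := by
  induction cmds generalizing net with
  | nil => exact h
  | cons cmd _ ih => exact ih (hI.command h cmd)

theorem realStep (hI : Pr.Preserves Z I) {w : RealWorld Pr A} (hw : I w.net w.party)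
    {a : EnvAction n In} {q : RealWorld Pr A × Obs Out}
    (hq : q ∈ (realStep Pr A Z w a).support) : I q.1.net q.1.party := by
  by_cases ha : a.IsPassive Z
  · obtain ⟨hparty, -, cmds, hnet⟩ := exists_of_mem_support_realStep_passive ha hq
    rw [hparty, hnet]
    exact hI.commands hw cmds
  · simp only [EnvAction.IsPassive, not_forall] at ha
    obtain ⟨i, x, rfl, hi⟩ := ha
    obtain ⟨_, _, rfl, r, hr, hparty, hnet, -⟩ := exists_of_mem_support_realStep_activate hi hq
    rw [hparty, hnet]
    exact hI.activation (hI.commands hw _) i hi x r hr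

theorem of_le (hI : Pr.Preserves Z I) {w₀ : RealWorld Pr A} {a : ℕ → EnvAction n In}
    {w : ℕ → RealWorld Pr A} (hw : IsRun (AsyncUC.realStep Pr A Z) w₀ a w) {k k' : ℕ}
    (hk : k ≤ k') (h : I (w k).net (w k).party) : I (w k').net (w k').party := by
  induction hk with
  | refl => exact h
  | step _ ih =>
    obtain ⟨o, ho⟩ := hw.2 _
    exact hI.realStep ih ho

end Protocol.Preserves

theorem preserves_prefix_traffic (Pr : Protocol n In Out) (Z : Finset (Fin n))
    (T : List (Fin n × Fin n × List Bool)) : Pr.Preserves Z fun net _ => T <+: traffic net where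
  command {net _} h cmd := by
    obtain ⟨L, hL, -⟩ := cmd.exists_traffic_apply Z net
    exact hL ▸ h.trans (List.prefix_append _ _)
  activation h i _ _ r _ := by
    rw [traffic_append, traffic_afterFetch]
    exact h.trans (List.prefix_append _ _)

theorem IsRun.traffic_prefix {w₀ : RealWorld Pr A} {a : ℕ → EnvAction n In}
    {w : ℕ → RealWorld Pr A} (hw : IsRun (realStep Pr A Z) w₀ a w) {k k' : ℕ} (hk : k ≤ k') :
    traffic (w k).net <+: traffic (w k').net :=
  (preserves_prefix_traffic Pr Z _).of_le hw hk List.prefix_rfl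

theorem getElem?_eq_some_of_prefix {α : Type*} {l l' : List α} (h : l <+: l') {k : ℕ} {x : α}
    (hk : l[k]? = some x) : l'[k]? = some x := by
  obtain ⟨hlt, rfl⟩ := List.getElem?_eq_some_iff.1 hk
  rw [h.getElem hlt, List.getElem?_eq_getElem]

theorem Adversary.EventualDelivery.exists_delivered {𝒵 : Finset (Finset (Fin n))}
    (hA : A.EventualDelivery 𝒵 Pr) (hZ : Corruptible 𝒵 Z) {z : List Bool}
    {a : ℕ → EnvAction n In} {w : ℕ → RealWorld Pr A}
    (hw : IsRun (realStep Pr A Z) (RealWorld.start Pr A Z z) a w) (ha : IsFair Z a) {k : ℕ}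
    {j i : Fin n} (hj : j ∉ Z) (hi : i ∉ Z) {b : List Bool} (hb : (j, i, b) ∈ traffic (w k).net) :
    ∃ k', Delivered (w k').net j i b := by
  obtain ⟨m, hm⟩ := List.mem_iff_getElem?.1 hb
  obtain ⟨p, hp, hpb⟩ : ∃ p, (w k).net[m]? = some p ∧ (p.src, p.dst, p.body) = (j, i, b) := by
    rwa [traffic, List.getElem?_map, Option.map_eq_some_iff] at hm
  simp only [Prod.mk.injEq] at hpb
  obtain ⟨k', p', hp', hdelivered⟩ :=
    hA Z hZ z a w hw ha k m p hp (hpb.1 ▸ hj) (hpb.2.1 ▸ hi)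
  have hm' : (traffic (w k').net)[m]? = some (p'.src, p'.dst, p'.body) := by
    rw [traffic, List.getElem?_map, hp', Option.map_some]
  have same_message : (p'.src, p'.dst, p'.body) = (j, i, b) := by
    rcases le_total k k' with hk | hk
    · exact Option.some.inj (hm'.symm.trans (getElem?_eq_some_of_prefix (hw.traffic_prefix hk) hm))
    · exact Option.some.inj ((getElem?_eq_some_of_prefix (hw.traffic_prefix hk) hm').symm.trans hm)
  simp only [Prod.mk.injEq] at same_message
  exact ⟨k', p', List.mem_of_getElem? hp', same_message.1, same_message.2.1, same_message.2.2,
    hdelivered⟩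

end RealWorld

section Encoding

theorem decode_encode (t : Kind) (m : List.Vector Bool ℓ) :
    decode ℓ (encode t m) = some (t, m) := by
  obtain ⟨l, hl⟩ := m
  cases t <;> simp [encode, decode, List.Vector.toList, hl]

theorem encode_inj {t t' : Kind} {m m' : List.Vector Bool ℓ} :
    encode t m = encode t' m' ↔ t = t' ∧ m = m' := by
  refine ⟨fun h => ?_, fun ⟨ht, hm⟩ => ht ▸ hm ▸ rfl⟩
  have h := congrArg (decode ℓ) h
  simpa only [decode_encode, Option.some.injEq, Prod.mk.injEq] using h

theorem decode_eq_none_or_exists_eq_encode (ℓ : ℕ) (b : List Bool) :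
    decode ℓ b = none ∨ ∃ (t : Kind) (m : List.Vector Bool ℓ), b = encode t m := by
  rcases b with _ | ⟨b₁, _ | ⟨b₂, l⟩⟩
  · exact .inl rfl
  · exact .inl rfl
  · by_cases hl : l.length = ℓ
    · rcases b₁ with _ | _ <;> rcases b₂ with _ | _
      · exact .inr ⟨.inp, ⟨l, hl⟩, rfl⟩
      · exact .inr ⟨.echo, ⟨l, hl⟩, rfl⟩
      · exact .inr ⟨.ready, ⟨l, hl⟩, rfl⟩
      · exact .inl (by simp [decode])
    · exact .inl (by simp [decode, hl])

theorem length_encode (t : Kind) (m : List.Vector Bool ℓ) : (encode t m).length = ℓ + 2 := by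
  cases t <;> simp [encode]

theorem mem_sendAll {d : Fin n} {t t' : Kind} {m m' : List.Vector Bool ℓ} :
    (d, encode t' m') ∈ sendAll (n := n) t m ↔ t' = t ∧ m' = m := by
  simp [sendAll, encode_inj, eq_comm]

theorem sum_length_sendAll (t : Kind) (m : List.Vector Bool ℓ) :
    ((sendAll (n := n) t m).map fun s => s.2.length).sum = n * (ℓ + 2) := by
  simp [sendAll, Function.comp_def, length_encode]

end Encoding

section PartyRules

namespace AcastState

/-- The party has sent its message of the given kind. -/
def flag (s : AcastState n ℓ) : Kind → Bool
  | .inp => s.started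
  | .echo => s.echoed
  | .ready => s.readied

/-- The state after the party has sent its message of the given kind. -/
def mark (s : AcastState n ℓ) : Kind → AcastState n ℓ
  | .inp => { s with started := true }
  | .echo => { s with echoed := true }
  | .ready => { s with readied := true }

/-- The number of messages that the party has sent to each party. -/
def sentCount (s : AcastState n ℓ) : ℕ := s.started.toNat + s.echoed.toNat + s.readied.toNat

/-- `s ≤ s'`: whatever a party in state `s` has sent, output or received, it has sent, output or
received in state `s'`. -/
instance : Preorder (AcastState n ℓ) :=
  Preorder.lift fun s => (s.flag, s.finished, s.echoes, s.readies)

theorem le_def {s s' : AcastState n ℓ} : s ≤ s' ↔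
    s.flag ≤ s'.flag ∧ s.finished ≤ s'.finished ∧ s.echoes ⊆ s'.echoes ∧ s.readies ⊆ s'.readies :=
  Iff.rfl

theorem flag_mono {s s' : AcastState n ℓ} (h : s ≤ s') {t : Kind} (ht : s.flag t = true) :
    s'.flag t = true :=
  h.1 t ht

theorem flag_eq_false_of_le {s s' : AcastState n ℓ} (h : s ≤ s') {t : Kind}
    (ht : s'.flag t = false) : s.flag t = false :=
  Bool.eq_false_of_not_eq_true fun hs => by simp [flag_mono h hs] at ht

theorem finished_mono {s s' : AcastState n ℓ} (h : s ≤ s') (hs : s.finished = true) :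
    s'.finished = true :=
  h.2.1 hs

@[simp] theorem flag_init (t : Kind) : (init n ℓ).flag t = false := by cases t <;> rfl

theorem flag_mark (s : AcastState n ℓ) (t t' : Kind) :
    (s.mark t).flag t' = true ↔ t' = t ∨ s.flag t' = true := by
  cases t <;> cases t' <;> simp [flag, mark]

@[simp] theorem finished_mark (s : AcastState n ℓ) (t : Kind) :
    (s.mark t).finished = s.finished := by
  cases t <;> rfl

@[simp] theorem echoes_mark (s : AcastState n ℓ) (t : Kind) : (s.mark t).echoes = s.echoes := by
  cases t <;> rfl

@[simp] theorem readies_mark (s : AcastState n ℓ) (t : Kind) : (s.mark t).readies = s.readies := by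
  cases t <;> rfl

theorem sentCount_mark {s : AcastState n ℓ} {t : Kind} (ht : s.flag t = false) :
    (s.mark t).sentCount = s.sentCount + 1 := by
  cases t <;> simp only [flag] at ht <;> simp [mark, sentCount, ht] <;> lia

theorem sentCount_le (s : AcastState n ℓ) : s.sentCount ≤ 3 := by
  have := s.started.toNat_le
  have := s.echoed.toNat_le
  have := s.readied.toNat_le
  unfold sentCount
  lia

theorem le_mark (s : AcastState n ℓ) (t : Kind) : s ≤ s.mark t :=
  le_def.2 ⟨fun t' ht' => (flag_mark s t t').2 (.inr ht'), by simp⟩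

end AcastState

namespace AcastLocal

/-- The party sends its message of kind `t`, with content `m`, to all parties. -/
def broadcast (c : AcastLocal n ℓ) (t : Kind) (m : List.Vector Bool ℓ) : AcastLocal n ℓ :=
  { c with st := c.st.mark t, sent := c.sent ++ sendAll t m }

/-- The party stores an `echo` of `j` for `m`. -/
def hearEcho (c : AcastLocal n ℓ) (j : Fin n) (m : List.Vector Bool ℓ) : AcastLocal n ℓ :=
  { c with st := { c.st with echoes := insert (j, m) c.st.echoes } }

/-- The party stores a `ready` of `j` for `m`. -/
def hearReady (c : AcastLocal n ℓ) (j : Fin n) (m : List.Vector Bool ℓ) : AcastLocal n ℓ :=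
  { c with st := { c.st with readies := insert (j, m) c.st.readies } }

/-- The party outputs `m`. -/
def finish (c : AcastLocal n ℓ) (m : List.Vector Bool ℓ) : AcastLocal n ℓ :=
  { c with st := { c.st with finished := true }, out := some m }

/-- Rule (2) of the protocol: a quorum of `echo` messages triggers a `ready` message. -/
def confirm (𝒵 : Finset (Finset (Fin n))) (c : AcastLocal n ℓ) (m : List.Vector Bool ℓ) :
    AcastLocal n ℓ :=
  if IsQuorum 𝒵 (sendersOf c.st.echoes m) then sendReady c m else c

/-- Rule (3) of the protocol: `ready` messages of an incorruptible set of parties trigger a `ready`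
message. -/
def amplify (𝒵 : Finset (Finset (Fin n))) (c : AcastLocal n ℓ) (m : List.Vector Bool ℓ) :
    AcastLocal n ℓ :=
  if ¬Corruptible 𝒵 (sendersOf c.st.readies m) then sendReady c m else c

/-- Rule (4) of the protocol: a quorum of `ready` messages triggers the output. -/
def conclude (𝒵 : Finset (Finset (Fin n))) (c : AcastLocal n ℓ) (m : List.Vector Bool ℓ) :
    AcastLocal n ℓ :=
  if IsQuorum 𝒵 (sendersOf c.st.readies m) then giveOutput c m else c

end AcastLocal

variable {𝒵 : Finset (Finset (Fin n))} {sender i : Fin n} {x : Option (List.Vector Bool ℓ)}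
  {recv : List (Fin n × List Bool)}

theorem sendReady_eq (c : AcastLocal n ℓ) (m : List.Vector Bool ℓ) :
    sendReady c m = if c.st.flag .ready = false then c.broadcast .ready m else c :=
  rfl

theorem giveOutput_eq (c : AcastLocal n ℓ) (m : List.Vector Bool ℓ) :
    giveOutput c m = if c.st.finished = false then c.finish m else c :=
  rfl

theorem acastInput_some (c : AcastLocal n ℓ) (m : List.Vector Bool ℓ) :
    acastInput sender i c (some m) =
      if i = sender ∧ c.st.flag .inp = false then c.broadcast .inp m else c :=
  rfl

theorem acastReceive_of_decode_eq_none {b : List Bool} (hb : decode ℓ b = none)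
    (c : AcastLocal n ℓ) (j : Fin n) : acastReceive 𝒵 sender c (j, b) = c := by
  simp only [acastReceive, hb]

theorem acastReceive_inp (c : AcastLocal n ℓ) (j : Fin n) (m : List.Vector Bool ℓ) :
    acastReceive 𝒵 sender c (j, encode .inp m) =
      if j = sender ∧ c.st.flag .echo = false then c.broadcast .echo m else c := by
  simp only [acastReceive, decode_encode]
  rfl

theorem acastReceive_echo (c : AcastLocal n ℓ) (j : Fin n) (m : List.Vector Bool ℓ) :
    acastReceive 𝒵 sender c (j, encode .echo m) = (c.hearEcho j m).confirm 𝒵 m := by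
  simp only [acastReceive, decode_encode]
  rfl

theorem acastReceive_ready (c : AcastLocal n ℓ) (j : Fin n) (m : List.Vector Bool ℓ) :
    acastReceive 𝒵 sender c (j, encode .ready m) =
      ((c.hearReady j m).amplify 𝒵 m).conclude 𝒵 m := by
  simp only [acastReceive, decode_encode]
  rfl

end PartyRules

section Moves

variable {𝒵 : Finset (Finset (Fin n))} {sender i : Fin n} {x : Option (List.Vector Bool ℓ)}
  {recv : List (Fin n × List Bool)}

/-- The protocol permits party `i`, which is in state `s` during an activation with input `x` and
received messages `recv`, to send the message of the given kind with content `m`. -/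
def Permits (𝒵 : Finset (Finset (Fin n))) (sender i : Fin n) (x : Option (List.Vector Bool ℓ))
    (recv : List (Fin n × List Bool)) (s : AcastState n ℓ) (m : List.Vector Bool ℓ) : Kind → Prop
  | .inp => i = sender ∧ x = some m
  | .echo => (sender, encode .inp m) ∈ recv
  | .ready => IsQuorum 𝒵 (sendersOf s.echoes m) ∨ ¬Corruptible 𝒵 (sendersOf s.readies m)

/-- The protocol as a transition system: the elementary steps of which an activation of party `i`
with input `x` and received messages `recv` is composed. Safety only depends on these. -/
inductive Move (𝒵 : Finset (Finset (Fin n))) (sender i : Fin n) (x : Option (List.Vector Bool ℓ))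
    (recv : List (Fin n × List Bool)) : AcastLocal n ℓ → AcastLocal n ℓ → Prop
  | broadcast {c t m} (fresh : c.st.flag t = false)
      (permitted : Permits 𝒵 sender i x recv c.st m t) : Move _ _ _ _ _ c (c.broadcast t m)
  | hearEcho {c j m} (received : (j, encode .echo m) ∈ recv) : Move _ _ _ _ _ c (c.hearEcho j m)
  | hearReady {c j m} (received : (j, encode .ready m) ∈ recv) :
      Move _ _ _ _ _ c (c.hearReady j m)
  | finish {c m} (fresh : c.st.finished = false)
      (quorum : IsQuorum 𝒵 (sendersOf c.st.readies m)) : Move _ _ _ _ _ c (c.finish m)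

/-- A sequence of elementary steps. -/
abbrev Moves (𝒵 : Finset (Finset (Fin n))) (sender i : Fin n) (x : Option (List.Vector Bool ℓ))
    (recv : List (Fin n × List Bool)) : AcastLocal n ℓ → AcastLocal n ℓ → Prop :=
  Relation.ReflTransGen (Move 𝒵 sender i x recv)

theorem moves_sendReady {c : AcastLocal n ℓ} {m : List.Vector Bool ℓ}
    (h : Permits 𝒵 sender i x recv c.st m .ready) :
    Moves 𝒵 sender i x recv c (sendReady c m) := by
  rw [sendReady_eq]
  split_ifs with fresh
  · exact .single (.broadcast fresh h)
  · exact .refl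

theorem moves_confirm (c : AcastLocal n ℓ) (m : List.Vector Bool ℓ) :
    Moves 𝒵 sender i x recv c (c.confirm 𝒵 m) := by
  rw [AcastLocal.confirm]
  split_ifs with quorum
  · exact moves_sendReady (.inl quorum)
  · exact .refl

theorem moves_amplify (c : AcastLocal n ℓ) (m : List.Vector Bool ℓ) :
    Moves 𝒵 sender i x recv c (c.amplify 𝒵 m) := by
  rw [AcastLocal.amplify]
  split_ifs with incorruptible
  · exact .refl
  · exact moves_sendReady (.inr incorruptible)

theorem moves_conclude (c : AcastLocal n ℓ) (m : List.Vector Bool ℓ) :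
    Moves 𝒵 sender i x recv c (c.conclude 𝒵 m) := by
  rw [AcastLocal.conclude, giveOutput_eq]
  split_ifs with quorum fresh
  · exact .single (.finish fresh quorum)
  all_goals exact .refl

theorem moves_acastReceive {r : Fin n × List Bool} (hr : r ∈ recv) (c : AcastLocal n ℓ) :
    Moves 𝒵 sender i x recv c (acastReceive 𝒵 sender c r) := by
  obtain ⟨j, b⟩ := r
  rcases decode_eq_none_or_exists_eq_encode ℓ b with hb | ⟨_ | _ | _, m, rfl⟩
  · rw [acastReceive_of_decode_eq_none hb]
  · rw [acastReceive_inp]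
    split_ifs with h
    · obtain ⟨rfl, fresh⟩ := h
      exact .single (.broadcast fresh hr)
    · exact .refl
  · rw [acastReceive_echo]
    exact .head (.hearEcho hr) (moves_confirm _ m)
  · rw [acastReceive_ready]
    exact .head (.hearReady hr) ((moves_amplify _ m).trans (moves_conclude _ m))

theorem moves_foldl_acastReceive {l : List (Fin n × List Bool)} (hl : l ⊆ recv)
    (c : AcastLocal n ℓ) : Moves 𝒵 sender i x recv c (l.foldl (acastReceive 𝒵 sender) c) := by
  induction l generalizing c with
  | nil => exact .refl
  | cons r l ih =>
    obtain ⟨hr, hl⟩ := List.cons_subset.1 hl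
    exact (moves_acastReceive hr c).trans (ih hl _)

theorem moves_acastInput (c : AcastLocal n ℓ) :
    Moves 𝒵 sender i x recv c (acastInput sender i c x) := by
  rcases x with _ | m
  · exact .refl
  · rw [acastInput_some]
    split_ifs with h
    · exact .single (.broadcast h.2 ⟨h.1, rfl⟩)
    · exact .refl

variable (𝒵 sender i x recv) in
theorem moves_acastActivation (s : AcastState n ℓ) :
    Moves 𝒵 sender i x recv ⟨s, [], none⟩ (acastActivation 𝒵 sender i s x recv) :=
  (moves_acastInput _).trans (moves_foldl_acastReceive (List.Subset.refl recv) _)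

section Effects

variable {c c' : AcastLocal n ℓ}

theorem Moves.le (h : Moves 𝒵 sender i x recv c c') : c.st ≤ c'.st := by
  induction h with
  | refl => exact le_rfl
  | tail _ move ih =>
    refine ih.trans ?_
    cases move with
    | broadcast => exact AcastState.le_mark _ _
    | hearEcho => exact ⟨le_rfl, le_rfl, Finset.subset_insert _ _, le_rfl⟩
    | hearReady => exact ⟨le_rfl, le_rfl, le_rfl, Finset.subset_insert _ _⟩
    | finish => exact ⟨le_rfl, Bool.le_true _, le_rfl, le_rfl⟩

theorem Moves.sent_prefix (h : Moves 𝒵 sender i x recv c c') : c.sent <+: c'.sent := by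
  induction h with
  | refl => exact List.prefix_rfl
  | tail _ move ih =>
    refine ih.trans ?_
    cases move with
    | broadcast => exact List.prefix_append _ _
    | hearEcho | hearReady | finish => exact List.prefix_rfl

theorem Moves.sum_length_sent (h : Moves 𝒵 sender i x recv c c') :
    (c'.sent.map fun s => s.2.length).sum + n * (ℓ + 2) * c.st.sentCount =
      (c.sent.map fun s => s.2.length).sum + n * (ℓ + 2) * c'.st.sentCount := by
  induction h with
  | refl => rfl
  | tail _ move ih =>
    cases move with
    | broadcast fresh =>
      simp only [AcastLocal.broadcast, AcastState.sentCount_mark fresh, List.map_append,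
        List.sum_append, sum_length_sendAll]
      linarith
    | hearEcho | hearReady | finish => exact ih

theorem Moves.out_eq_none_or_exists (h : Moves 𝒵 sender i x recv c c') (hc : c.out = none) :
    c'.out = none ∧ c'.st.finished = c.st.finished ∨
      ∃ m, c'.out = some m ∧ c.st.finished = false ∧ c'.st.finished = true := by
  induction h with
  | refl => exact .inl ⟨hc, rfl⟩
  | tail _ move ih =>
    cases move with
    | broadcast => simpa [AcastLocal.broadcast] using ih
    | hearEcho | hearReady => exact ih
    | finish fresh =>
      rcases ih with ⟨-, hfin⟩ | ⟨_, -, -, hfin⟩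
      · exact .inr ⟨_, rfl, hfin ▸ fresh, rfl⟩
      · exact absurd hfin (by simp [fresh])

theorem Moves.of_mem_sent_inp (h : Moves 𝒵 sender i x recv c c') {d : Fin n}
    {m : List.Vector Bool ℓ} (hm : (d, encode .inp m) ∈ c'.sent) :
    (d, encode .inp m) ∈ c.sent ∨ i = sender ∧ x = some m ∧ c.st.started = false := by
  induction h with
  | refl => exact .inl hm
  | tail moves move ih =>
    cases move with
    | broadcast fresh permitted =>
      rcases List.mem_append.1 hm with hm | hm
      · exact ih hm
      · obtain ⟨rfl, rfl⟩ := mem_sendAll.1 hm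
        exact .inr ⟨permitted.1, permitted.2, AcastState.flag_eq_false_of_le (Moves.le moves) fresh⟩
    | hearEcho | hearReady | finish => exact ih hm

end Effects

theorem mem_sent_acastActivation_inp {s : AcastState n ℓ} {d : Fin n} {m : List.Vector Bool ℓ} :
    (d, encode .inp m) ∈ (acastActivation 𝒵 sender i s x recv).sent ↔
      i = sender ∧ x = some m ∧ s.started = false := by
  refine ⟨fun h => ?_, ?_⟩
  · simpa using (moves_acastActivation 𝒵 sender i x recv s).of_mem_sent_inp h
  · rintro ⟨rfl, rfl, hs⟩
    have moves := moves_foldl_acastReceive (𝒵 := 𝒵) (sender := i) (i := i) (x := some m)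
      (List.Subset.refl recv) (acastInput i i ⟨s, [], none⟩ (some m))
    refine moves.sent_prefix.subset ?_
    simp [acastInput, hs, mem_sendAll]

theorem acastActivation_congr {s : AcastState n ℓ} {x x' : Option (List.Vector Bool ℓ)}
    (h : i = sender → s.started = false → x = x') :
    acastActivation 𝒵 sender i s x recv = acastActivation 𝒵 sender i s x' recv := by
  have ignored (hs : ¬(i = sender ∧ s.started = false)) (x : Option (List.Vector Bool ℓ)) :
      acastInput sender i ⟨s, [], none⟩ x = ⟨s, [], none⟩ := by
    rcases x with _ | m
    · rfl
    · exact if_neg hs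
  by_cases hs : i = sender ∧ s.started = false
  · rw [h hs.1 hs.2]
  · rw [acastActivation, acastActivation, ignored hs, ignored hs]

end Moves

section Completeness

variable {𝒵 : Finset (Finset (Fin n))} {sender i : Fin n} {x : Option (List.Vector Bool ℓ)}
  {recv : List (Fin n × List Bool)}

theorem mem_sendersOf {R : Finset (Fin n × List.Vector Bool ℓ)} {m : List.Vector Bool ℓ}
    {j : Fin n} : j ∈ sendersOf R m ↔ (j, m) ∈ R := by
  simp [sendersOf]

theorem sendersOf_insert_of_ne {R : Finset (Fin n × List.Vector Bool ℓ)}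
    {m m' : List.Vector Bool ℓ} (h : m' ≠ m) (j : Fin n) :
    sendersOf (insert (j, m) R) m' = sendersOf R m' := by
  ext j'
  simp [mem_sendersOf, h]

namespace AcastState

/-- A party in state `s` has processed the message of the given kind, with content `m`, that it has
received from `j`. -/
def Heard (sender : Fin n) (s : AcastState n ℓ) (j : Fin n) (m : List.Vector Bool ℓ) :
    Kind → Prop
  | .inp => j = sender → s.flag .echo = true
  | .echo => (j, m) ∈ s.echoes
  | .ready => (j, m) ∈ s.readies

/-- A party in state `s` has applied the rules (2), (3), (4) of the protocol wherever they apply. -/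
structure Saturated (𝒵 : Finset (Finset (Fin n))) (s : AcastState n ℓ) : Prop where
  confirmed : ∀ m, IsQuorum 𝒵 (sendersOf s.echoes m) → s.flag .ready = true
  amplified : ∀ m, ¬Corruptible 𝒵 (sendersOf s.readies m) → s.flag .ready = true
  concluded : ∀ m, IsQuorum 𝒵 (sendersOf s.readies m) → s.finished = true

theorem Heard.mono {s s' : AcastState n ℓ} {j : Fin n} {t : Kind} {m : List.Vector Bool ℓ}
    (h : s.Heard sender j m t) (hs : s ≤ s') : s'.Heard sender j m t := by
  cases t with
  | inp => exact fun hj => flag_mono hs (h hj)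
  | echo => exact hs.2.2.1 h
  | ready => exact hs.2.2.2 h

end AcastState

namespace AcastLocal

variable (c : AcastLocal n ℓ) (m : List.Vector Bool ℓ)

theorem echoes_readies_sendReady : (sendReady c m).st.echoes = c.st.echoes ∧
    (sendReady c m).st.readies = c.st.readies := by
  rw [sendReady]
  split_ifs <;> exact ⟨rfl, rfl⟩

theorem echoes_readies_confirm : (c.confirm 𝒵 m).st.echoes = c.st.echoes ∧
    (c.confirm 𝒵 m).st.readies = c.st.readies := by
  rw [confirm]
  split_ifs
  exacts [echoes_readies_sendReady c m, ⟨rfl, rfl⟩]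

theorem echoes_readies_amplify : (c.amplify 𝒵 m).st.echoes = c.st.echoes ∧
    (c.amplify 𝒵 m).st.readies = c.st.readies := by
  rw [amplify]
  split_ifs
  exacts [⟨rfl, rfl⟩, echoes_readies_sendReady c m]

theorem echoes_readies_conclude : (c.conclude 𝒵 m).st.echoes = c.st.echoes ∧
    (c.conclude 𝒵 m).st.readies = c.st.readies := by
  rw [conclude, giveOutput]
  split_ifs <;> exact ⟨rfl, rfl⟩

theorem readied_sendReady : (sendReady c m).st.flag .ready = true := by
  rw [sendReady_eq]
  split_ifs with h
  · rfl
  · simpa using h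

variable {c m}

theorem readied_confirm (h : IsQuorum 𝒵 (sendersOf c.st.echoes m)) :
    (c.confirm 𝒵 m).st.flag .ready = true := by
  rw [confirm, if_pos h]
  exact readied_sendReady c m

theorem readied_amplify (h : ¬Corruptible 𝒵 (sendersOf c.st.readies m)) :
    (c.amplify 𝒵 m).st.flag .ready = true := by
  rw [amplify, if_pos h]
  exact readied_sendReady c m

theorem finished_conclude (h : IsQuorum 𝒵 (sendersOf c.st.readies m)) :
    (c.conclude 𝒵 m).st.finished = true := by
  rw [conclude, if_pos h, giveOutput]
  split_ifs with hfin
  · rfl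
  · simpa using hfin

end AcastLocal

theorem le_acastReceive (c : AcastLocal n ℓ) (r : Fin n × List Bool) :
    c.st ≤ (acastReceive 𝒵 sender c r).st :=
  (moves_acastReceive (i := sender) (x := none) (List.mem_singleton_self r) c).le

theorem le_foldl_acastReceive (c : AcastLocal n ℓ) (l : List (Fin n × List Bool)) :
    c.st ≤ (l.foldl (acastReceive 𝒵 sender) c).st :=
  (moves_foldl_acastReceive (i := sender) (x := none) (List.Subset.refl l) c).le

theorem heard_acastReceive (c : AcastLocal n ℓ) (j : Fin n) (t : Kind)
    (m : List.Vector Bool ℓ) :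
    (acastReceive 𝒵 sender c (j, encode t m)).st.Heard sender j m t := by
  cases t with
  | inp =>
    rintro rfl
    rw [acastReceive_inp]
    split_ifs with h
    · rfl
    · simpa using h
  | echo =>
    rw [acastReceive_echo, AcastState.Heard, (AcastLocal.echoes_readies_confirm _ m).1]
    exact Finset.mem_insert_self _ _
  | ready =>
    rw [acastReceive_ready, AcastState.Heard, (AcastLocal.echoes_readies_conclude _ m).2,
      (AcastLocal.echoes_readies_amplify _ m).2]
    exact Finset.mem_insert_self _ _

theorem heard_acastActivation (s : AcastState n ℓ) {j : Fin n} {t : Kind} {m : List.Vector Bool ℓ}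
    (h : (j, encode t m) ∈ recv) :
    (acastActivation 𝒵 sender i s x recv).st.Heard sender j m t := by
  obtain ⟨before, after, rfl⟩ := List.append_of_mem h
  rw [acastActivation, List.foldl_append, List.foldl_cons]
  exact (heard_acastReceive _ j t m).mono (le_foldl_acastReceive _ after)

theorem AcastState.Saturated.hearEcho {c : AcastLocal n ℓ} (h : c.st.Saturated 𝒵) (j : Fin n)
    (m : List.Vector Bool ℓ) : ((c.hearEcho j m).confirm 𝒵 m).st.Saturated 𝒵 := by
  obtain ⟨echoes_eq, readies_eq⟩ := AcastLocal.echoes_readies_confirm (𝒵 := 𝒵) (c.hearEcho j m) m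
  have hle : c.st ≤ ((c.hearEcho j m).confirm 𝒵 m).st :=
    acastReceive_echo (𝒵 := 𝒵) (sender := j) c j m ▸ le_acastReceive c _
  refine ⟨fun m' hm' => ?_, fun m' hm' => ?_, fun m' hm' => ?_⟩
  · rw [echoes_eq] at hm'
    by_cases hmm : m' = m
    · subst hmm
      exact AcastLocal.readied_confirm hm'
    · rw [AcastLocal.hearEcho, sendersOf_insert_of_ne hmm] at hm'
      exact flag_mono hle (h.confirmed m' hm')
  · exact flag_mono hle (h.amplified m' (readies_eq ▸ hm'))
  · exact finished_mono hle (h.concluded m' (readies_eq ▸ hm'))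

theorem AcastState.Saturated.hearReady {c : AcastLocal n ℓ} (h : c.st.Saturated 𝒵) (j : Fin n)
    (m : List.Vector Bool ℓ) :
    (((c.hearReady j m).amplify 𝒵 m).conclude 𝒵 m).st.Saturated 𝒵 := by
  set c₁ := (c.hearReady j m).amplify 𝒵 m
  obtain ⟨echoes_eq₁, readies_eq₁⟩ :=
    AcastLocal.echoes_readies_amplify (𝒵 := 𝒵) (c.hearReady j m) m
  obtain ⟨echoes_eq, readies_eq⟩ := AcastLocal.echoes_readies_conclude (𝒵 := 𝒵) c₁ m
  have hle : c.st ≤ (c₁.conclude 𝒵 m).st :=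
    acastReceive_ready (𝒵 := 𝒵) (sender := j) c j m ▸ le_acastReceive c _
  have hle₁ : c₁.st ≤ (c₁.conclude 𝒵 m).st :=
    (moves_conclude (sender := j) (i := j) (x := none) (recv := []) c₁ m).le
  refine ⟨fun m' hm' => ?_, fun m' hm' => ?_, fun m' hm' => ?_⟩
  · exact flag_mono hle (h.confirmed m' (echoes_eq₁ ▸ echoes_eq ▸ hm'))
  · rw [readies_eq, readies_eq₁] at hm'
    by_cases hmm : m' = m
    · subst hmm
      exact flag_mono hle₁ (AcastLocal.readied_amplify hm')
    · rw [AcastLocal.hearReady, sendersOf_insert_of_ne hmm] at hm'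
      exact flag_mono hle (h.amplified m' hm')
  · rw [readies_eq] at hm'
    by_cases hmm : m' = m
    · subst hmm
      exact AcastLocal.finished_conclude hm'
    · rw [readies_eq₁, AcastLocal.hearReady, sendersOf_insert_of_ne hmm] at hm'
      exact finished_mono hle (h.concluded m' hm')

theorem AcastState.Saturated.acastReceive {c : AcastLocal n ℓ} (h : c.st.Saturated 𝒵)
    (r : Fin n × List Bool) : (acastReceive 𝒵 sender c r).st.Saturated 𝒵 := by
  obtain ⟨j, b⟩ := r
  rcases decode_eq_none_or_exists_eq_encode ℓ b with hb | ⟨_ | _ | _, m, rfl⟩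
  · rwa [acastReceive_of_decode_eq_none hb]
  · rw [acastReceive_inp]
    split_ifs
    exacts [⟨h.confirmed, h.amplified, h.concluded⟩, h]
  · rw [acastReceive_echo]
    exact h.hearEcho j m
  · rw [acastReceive_ready]
    exact h.hearReady j m

theorem AcastState.Saturated.acastActivation {s : AcastState n ℓ} (h : s.Saturated 𝒵) :
    (acastActivation 𝒵 sender i s x recv).st.Saturated 𝒵 := by
  have saturated_input : (acastInput sender i ⟨s, [], none⟩ x).st.Saturated 𝒵 := by
    rcases x with _ | m
    · exact h
    · rw [acastInput_some]
      split_ifs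
      exacts [⟨h.confirmed, h.amplified, h.concluded⟩, h]
  rw [AsyncUC.acastActivation]
  generalize acastInput sender i ⟨s, [], none⟩ x = c at saturated_input ⊢
  induction recv generalizing c with
  | nil => exact saturated_input
  | cons r _ ih => exact ih _ (saturated_input.acastReceive r)

end Completeness

section Soundness

variable {𝒵 : Finset (Finset (Fin n))} {sender i : Fin n} {Z : Finset (Fin n)}
  {T L : List (Fin n × Fin n × List Bool)}

/-- Party `j` has sent a message of kind `t` with content `m` to some party. -/
def Said (T : List (Fin n × Fin n × List Bool)) (j : Fin n) (t : Kind)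
    (m : List.Vector Bool ℓ) : Prop :=
  ∃ d, (j, d, encode t m) ∈ T

/-- The honest members of a quorum have sent messages of kind `t` with content `m`. -/
def Backed (𝒵 : Finset (Finset (Fin n))) (Z : Finset (Fin n))
    (T : List (Fin n × Fin n × List Bool)) (t : Kind) (m : List.Vector Bool ℓ) : Prop :=
  ∃ Z' ∈ 𝒵, ∀ j ∉ Z, j ∉ Z' → Said T j t m

/-- The safety invariant of an honest party `i` in state `s`, relative to the traffic `T`. -/
structure PartySound (𝒵 : Finset (Finset (Fin n))) (sender : Fin n) (Z : Finset (Fin n))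
    (T : List (Fin n × Fin n × List Bool)) (i : Fin n) (s : AcastState n ℓ) : Prop where
  unique : ∀ {t} {m m' : List.Vector Bool ℓ}, Said T i t m → Said T i t m' → m = m'
  flag_iff : ∀ t, s.flag t = true ↔ ∃ m : List.Vector Bool ℓ, Said T i t m
  to_all : ∀ {t} {m : List.Vector Bool ℓ}, Said T i t m → ∀ d, (i, d, encode t m) ∈ T
  echoes : ∀ {j m}, (j, m) ∈ s.echoes → Said T j .echo m
  readies : ∀ {j m}, (j, m) ∈ s.readies → Said T j .ready m
  echo_valid : ∀ {m : List.Vector Bool ℓ}, Said T i .echo m → Said T sender .inp m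
  ready_backed : ∀ {m : List.Vector Bool ℓ}, Said T i .ready m → Backed 𝒵 Z T .echo m

/-- The safety invariant of the protocol. -/
def Sound (𝒵 : Finset (Finset (Fin n))) (sender : Fin n) (Z : Finset (Fin n))
    (T : List (Fin n × Fin n × List Bool)) (party : Fin n → AcastState n ℓ) : Prop :=
  ∀ i ∉ Z, PartySound 𝒵 sender Z T i (party i)

theorem said_append {j : Fin n} {t : Kind} {m : List.Vector Bool ℓ} :
    Said (T ++ L) j t m ↔ Said T j t m ∨ Said L j t m := by
  simp [Said, exists_or]

theorem said_sentBy {j : Fin n} {t : Kind} {m : List.Vector Bool ℓ}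
    {l : List (Fin n × List Bool)} :
    Said (sentBy i l) j t m ↔ j = i ∧ ∃ d, (d, encode t m) ∈ l := by
  simp [Said, mem_sentBy]

theorem said_sentBy_sendAll {j : Fin n} {t t' : Kind} {m m' : List.Vector Bool ℓ} :
    Said (sentBy i (sendAll t m)) j t' m' ↔ j = i ∧ t' = t ∧ m' = m := by
  simp [said_sentBy, mem_sendAll, Nonempty.intro i]

theorem Said.mono {T' : List (Fin n × Fin n × List Bool)} {j : Fin n} {t : Kind}
    {m : List.Vector Bool ℓ} (h : Said T j t m) (hT : T ⊆ T') : Said T' j t m :=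
  h.imp fun _ hd => hT hd

theorem Backed.mono {T' : List (Fin n × Fin n × List Bool)} {t : Kind} {m : List.Vector Bool ℓ}
    (h : Backed 𝒵 Z T t m) (hT : T ⊆ T') : Backed 𝒵 Z T' t m :=
  h.imp fun _ hZ' => hZ'.imp_right fun said j hj hj' => (said j hj hj').mono hT

theorem IsQuorum.backed {R : Finset (Fin n × List.Vector Bool ℓ)} {t : Kind}
    {m : List.Vector Bool ℓ} (h : IsQuorum 𝒵 (sendersOf R m))
    (hR : ∀ {j}, (j, m) ∈ R → Said T j t m) : Backed 𝒵 Z T t m := by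
  obtain ⟨Z', hZ', hsub⟩ := h
  exact ⟨Z', hZ', fun j _ hj => hR (mem_sendersOf.1 (hsub (by simp [hj])))⟩

namespace PartySound

variable {s : AcastState n ℓ}

theorem init : PartySound 𝒵 sender Z [] i (AcastState.init n ℓ) where
  unique := by simp [Said]
  flag_iff := by simp [Said]
  to_all := by simp [Said]
  echoes := by simp [AcastState.init]
  readies := by simp [AcastState.init]
  echo_valid := by simp [Said]
  ready_backed := by simp [Said]

theorem append (h : PartySound 𝒵 sender Z T i s) (hL : ∀ x ∈ L, x.1 ≠ i) :
    PartySound 𝒵 sender Z (T ++ L) i s := by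
  have sub : T ⊆ T ++ L := List.subset_append_left T L
  have old {t : Kind} {m : List.Vector Bool ℓ} : Said (T ++ L) i t m ↔ Said T i t m :=
    said_append.trans (or_iff_left fun ⟨_, hd⟩ => hL _ hd rfl)
  constructor
  case unique => exact fun hm hm' => h.unique (old.1 hm) (old.1 hm')
  case flag_iff => exact fun t => (h.flag_iff t).trans (exists_congr fun _ => old.symm)
  case to_all => exact fun hm d => sub (h.to_all (old.1 hm) d)
  case echoes => exact fun hj => (h.echoes hj).mono sub
  case readies => exact fun hj => (h.readies hj).mono sub
  case echo_valid => exact fun hm => (h.echo_valid (old.1 hm)).mono sub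
  case ready_backed => exact fun hm => (h.ready_backed (old.1 hm)).mono sub

theorem broadcast (h : PartySound 𝒵 sender Z T i s) {t : Kind} {m : List.Vector Bool ℓ}
    (fresh : s.flag t = false) (hecho : t = .echo → Said T sender .inp m)
    (hready : t = .ready → Backed 𝒵 Z T .echo m) :
    PartySound 𝒵 sender Z (T ++ sentBy i (sendAll t m)) i (s.mark t) := by
  have sub : T ⊆ T ++ sentBy i (sendAll t m) := List.subset_append_left _ _
  have said_iff {t' : Kind} {m' : List.Vector Bool ℓ} :
      Said (T ++ sentBy i (sendAll t m)) i t' m' ↔ Said T i t' m' ∨ t' = t ∧ m' = m := by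
    rw [said_append, said_sentBy_sendAll, eq_self, true_and]
  have not_said (m' : List.Vector Bool ℓ) : ¬Said T i t m' := fun hm' => by
    simp [(h.flag_iff t).2 ⟨m', hm'⟩] at fresh
  constructor
  case unique =>
    intro t' m₁ m₂ h₁ h₂
    rcases said_iff.1 h₁ with old₁ | ⟨ht, rfl⟩ <;> rcases said_iff.1 h₂ with old₂ | ⟨ht', rfl⟩
    · exact h.unique old₁ old₂
    · exact absurd (ht' ▸ old₁) (not_said _)
    · exact absurd (ht ▸ old₂) (not_said _)
    · rfl
  case flag_iff =>
    intro t'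
    rw [AcastState.flag_mark, h.flag_iff]
    simp only [said_iff, exists_or, exists_and_left, exists_eq, and_true]
    exact or_comm
  case to_all =>
    intro t' m' hm' d
    rcases said_iff.1 hm' with hm' | ⟨rfl, rfl⟩
    · exact sub (h.to_all hm' d)
    · exact List.mem_append_right _ (mem_sentBy.2 ⟨rfl, mem_sendAll.2 ⟨rfl, rfl⟩⟩)
  case echoes => exact fun hj => (h.echoes (by simpa using hj)).mono sub
  case readies => exact fun hj => (h.readies (by simpa using hj)).mono sub
  case echo_valid =>
    intro m' hm'
    rcases said_iff.1 hm' with hm' | ⟨ht, rfl⟩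
    · exact (h.echo_valid hm').mono sub
    · exact (hecho ht.symm).mono sub
  case ready_backed =>
    intro m' hm'
    rcases said_iff.1 hm' with hm' | ⟨ht, rfl⟩
    · exact (h.ready_backed hm').mono sub
    · exact (hready ht.symm).mono sub

end PartySound

namespace Sound

variable {party : Fin n → AcastState n ℓ}

theorem init : Sound 𝒵 sender Z [] fun _ => AcastState.init n ℓ := fun _ _ => .init

theorem append (h : Sound 𝒵 sender Z T party) (hL : ∀ x ∈ L, x.1 ∈ Z) :
    Sound 𝒵 sender Z (T ++ L) party :=
  fun i hi => (h i hi).append fun x hx hxi => hi (hxi ▸ hL x hx)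

theorem append_sentBy (h : Sound 𝒵 sender Z T party) {l : List (Fin n × List Bool)}
    {s : AcastState n ℓ} (hi : PartySound 𝒵 sender Z (T ++ sentBy i l) i s) :
    Sound 𝒵 sender Z (T ++ sentBy i l) (Function.update party i s) := by
  intro j hj
  rcases eq_or_ne j i with rfl | hji
  · rwa [Function.update_self]
  · rw [Function.update_of_ne hji]
    refine (h j hj).append fun ⟨_, _, _⟩ hx hxj => hji ?_
    exact hxj.symm.trans (mem_sentBy.1 hx).1

/-- An incorruptible set contains an honest party, whose `ready` is backed. -/
theorem backed_echo_of_permits (h : Sound 𝒵 sender Z T party) (hZ : Corruptible 𝒵 Z) (hi : i ∉ Z)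
    {x : Option (List.Vector Bool ℓ)} {recv : List (Fin n × List Bool)} {m : List.Vector Bool ℓ}
    (permitted : Permits 𝒵 sender i x recv (party i) m .ready) : Backed 𝒵 Z T .echo m := by
  rcases permitted with quorum | incorruptible
  · exact quorum.backed (h i hi).echoes
  · obtain ⟨j, hjm, hj⟩ : ∃ j ∈ sendersOf (party i).readies m, j ∉ Z := by
      obtain ⟨Z₁, hZ₁, hsub⟩ := hZ
      by_contra! hall
      exact incorruptible ⟨Z₁, hZ₁, fun j hj => hsub (hall j hj)⟩
    exact (h j hj).ready_backed ((h i hi).readies (mem_sendersOf.1 hjm))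

theorem moves (h : Sound 𝒵 sender Z T party) (hZ : Corruptible 𝒵 Z) (hi : i ∉ Z)
    {x : Option (List.Vector Bool ℓ)} {recv : List (Fin n × List Bool)}
    (hrecv : ∀ {r}, r ∈ recv → (r.1, i, r.2) ∈ T) {c : AcastLocal n ℓ}
    (hc : Moves 𝒵 sender i x recv ⟨party i, [], none⟩ c) :
    Sound 𝒵 sender Z (T ++ sentBy i c.sent) (Function.update party i c.st) ∧
      ∀ {m}, c.out = some m → Backed 𝒵 Z (T ++ sentBy i c.sent) .ready m := by
  have sub (l : List (Fin n × List Bool)) : T ⊆ T ++ sentBy i l := List.subset_append_left _ _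
  induction hc with
  | refl => simpa [sentBy] using h
  | @tail c _ _ move ih =>
    obtain ⟨ih, ih_out⟩ := ih
    have ih_i := ih i hi
    rw [Function.update_self] at ih_i
    cases move with
    | @broadcast t m fresh permitted =>
      have step_i := ih_i.broadcast (m := m) fresh
        (by rintro rfl; exact Said.mono ⟨i, hrecv permitted⟩ (sub _))
        (by rintro rfl; exact ih.backed_echo_of_permits (x := x) (recv := recv) hZ hi
              (by rwa [Function.update_self]))
      rw [List.append_assoc, ← sentBy_append] at step_i
      refine ⟨h.append_sentBy step_i, fun hm => (ih_out hm).mono ?_⟩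
      rw [AcastLocal.broadcast, sentBy_append, ← List.append_assoc]
      exact List.subset_append_left _ _
    | hearEcho received =>
      refine ⟨h.append_sentBy { ih_i with echoes := fun hj => ?_ }, ih_out⟩
      rcases Finset.mem_insert.1 hj with hj | hj
      · obtain ⟨rfl, rfl⟩ := Prod.mk.inj hj
        exact Said.mono ⟨i, hrecv received⟩ (sub _)
      · exact ih_i.echoes hj
    | hearReady received =>
      refine ⟨h.append_sentBy { ih_i with readies := fun hj => ?_ }, ih_out⟩
      rcases Finset.mem_insert.1 hj with hj | hj
      · obtain ⟨rfl, rfl⟩ := Prod.mk.inj hj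
        exact Said.mono ⟨i, hrecv received⟩ (sub _)
      · exact ih_i.readies hj
    | finish _ quorum =>
      refine ⟨h.append_sentBy { ih_i with }, fun hm => ?_⟩
      obtain rfl := Option.some.inj hm
      exact quorum.backed ih_i.readies

end Sound

end Soundness

section Invariants

variable {𝒵 : Finset (Finset (Fin n))} {sender : Fin n} {Z : Finset (Fin n)}

theorem preserves_sound (hZ : Corruptible 𝒵 Z) :
    (AcastProtocol 𝒵 ℓ sender).Preserves Z fun net party =>
      Sound 𝒵 sender Z (traffic net) party where
  command h cmd := by
    obtain ⟨L, hL, hLZ⟩ := cmd.exists_traffic_apply Z _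
    exact hL ▸ h.append hLZ
  activation h i hi x r hr := by
    obtain rfl := (PMF.mem_support_pure_iff _ _).1 hr
    rw [traffic_append, traffic_afterFetch, traffic_outgoing]
    exact (h.moves hZ hi mem_traffic_of_mem_released (moves_acastActivation 𝒵 sender i x _ _)).1

theorem preserves_saturated :
    (AcastProtocol 𝒵 ℓ sender).Preserves Z fun _ party =>
      ∀ i, AcastState.Saturated 𝒵 (party i) where
  command h _ := h
  activation h i _ x r hr j := by
    obtain rfl := (PMF.mem_support_pure_iff _ _).1 hr
    rcases eq_or_ne j i with rfl | hji
    · rw [Function.update_self]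
      exact (h j).acastActivation
    · rw [Function.update_of_ne hji]
      exact h j

theorem preserves_le (party₀ : Fin n → AcastState n ℓ) :
    (AcastProtocol 𝒵 ℓ sender).Preserves Z fun _ party => ∀ i, party₀ i ≤ party i where
  command h _ := h
  activation h i _ x r hr j := by
    obtain rfl := (PMF.mem_support_pure_iff _ _).1 hr
    rcases eq_or_ne j i with rfl | hji
    · rw [Function.update_self]
      exact (h j).trans (moves_acastActivation 𝒵 sender j x _ _).le
    · rw [Function.update_of_ne hji]
      exact h j

theorem preserves_heard :
    (AcastProtocol 𝒵 ℓ sender).Preserves Z fun net party => ∀ j i t m, i ∉ Z →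
      Delivered net j i (encode t m) → AcastState.Heard sender (party i) j m t where
  command h _ _ _ _ _ hi hdelivered := h _ _ _ _ hi (NetCmd.delivered_of_apply hdelivered)
  activation {_ party} h i hi x r hr j d t m hd hdelivered := by
    rcases delivered_of_afterFetch_append hdelivered with hdelivered | ⟨rfl, hreleased⟩
    · have party_le := (preserves_le party).activation (fun _ => Preorder.le_refl _) i hi x r hr
      exact (h j d t m hd hdelivered).mono (party_le d)
    · obtain rfl := (PMF.mem_support_pure_iff _ _).1 hr
      rw [Function.update_self]
      exact heard_acastActivation _ hreleased

end Invariants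

section Communication

/-- The number of bits that `i` has sent. -/
def bitsFrom (i : Fin n) (T : List (Fin n × Fin n × List Bool)) : ℕ :=
  (T.map fun x => if x.1 = i then x.2.2.length else 0).sum

theorem bitsFrom_append (i : Fin n) (T L : List (Fin n × Fin n × List Bool)) :
    bitsFrom i (T ++ L) = bitsFrom i T + bitsFrom i L := by
  simp [bitsFrom]

theorem bitsFrom_sentBy_self (i : Fin n) (l : List (Fin n × List Bool)) :
    bitsFrom i (sentBy i l) = (l.map fun s => s.2.length).sum := by
  simp [bitsFrom, sentBy, Function.comp_def]

theorem bitsFrom_eq_zero {i : Fin n} {L : List (Fin n × Fin n × List Bool)}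
    (hL : ∀ x ∈ L, x.1 ≠ i) : bitsFrom i L = 0 :=
  List.sum_eq_zero <| List.forall_mem_map.2 fun x hx => if_neg (hL x hx)

theorem honestBits_eq_sum {In Out : Type} {Pr : Protocol n In Out} {A : Adversary n In}
    (Z : Finset (Fin n)) (w : RealWorld Pr A) :
    w.honestBits Z = ∑ i ∈ Finset.univ \ Z, bitsFrom i (traffic w.net) := by
  rw [RealWorld.honestBits]
  induction w.net with
  | nil => simp [bitsFrom, traffic]
  | cons p net ih =>
    have split_first (i : Fin n) : bitsFrom i (traffic (p :: net)) =
        (if p.src = i then p.body.length else 0) + bitsFrom i (traffic net) := by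
      simp [bitsFrom, traffic]
    simp only [split_first, Finset.sum_add_distrib, Finset.sum_ite_eq, ← ih]
    by_cases hp : p.src ∈ Z <;> simp [hp]

variable {𝒵 : Finset (Finset (Fin n))} {sender : Fin n} {Z : Finset (Fin n)}

theorem preserves_bitsFrom :
    (AcastProtocol 𝒵 ℓ sender).Preserves Z fun net party => ∀ i ∉ Z,
      bitsFrom i (traffic net) = n * (ℓ + 2) * AcastState.sentCount (party i) where
  command h cmd i hi := by
    obtain ⟨L, hL, hLZ⟩ := cmd.exists_traffic_apply Z _
    have silent : bitsFrom i L = 0 := bitsFrom_eq_zero fun x hx hxi => hi (hxi ▸ hLZ x hx)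
    rw [hL, bitsFrom_append, silent, add_zero]
    exact h i hi
  activation {net party} h i _ x r hr j hj := by
    obtain rfl := (PMF.mem_support_pure_iff _ _).1 hr
    rw [traffic_append, traffic_afterFetch, traffic_outgoing, bitsFrom_append, h j hj]
    rcases eq_or_ne j i with rfl | hji
    · rw [bitsFrom_sentBy_self, Function.update_self, add_comm]
      simpa using (moves_acastActivation 𝒵 sender j x (released j net) (party j)).sum_length_sent
    · rw [Function.update_of_ne hji, bitsFrom_eq_zero, add_zero]
      exact fun ⟨_, _, _⟩ hx hxj => hji (hxj.symm.trans (mem_sentBy.1 hx).1)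

theorem acastProtocol_communicationAtMost (𝒵 : Finset (Finset (Fin n))) (ℓ : ℕ)
    (sender : Fin n) :
    (AcastProtocol 𝒵 ℓ sender).CommunicationAtMost 𝒵 (3 * (n ^ 2 * (ℓ + 2))) := by
  intro A Z _ z a w hw k
  have bits := preserves_bitsFrom.of_le (Z := Z) hw k.zero_le <| by
    rw [hw.1]
    intro i _
    simp [RealWorld.start, AcastProtocol, bitsFrom, traffic, AcastState.sentCount, AcastState.init]
  calc
    (w k).honestBits Z = ∑ i ∈ Finset.univ \ Z, bitsFrom i (traffic (w k).net) :=
      honestBits_eq_sum Z (w k)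
    _ ≤ ∑ i ∈ Finset.univ \ Z, n * (ℓ + 2) * 3 := by
      refine Finset.sum_le_sum fun i hi => ?_
      rw [bits i (Finset.mem_sdiff.1 hi).2]
      exact Nat.mul_le_mul_left _ (AcastState.sentCount_le _)
    _ ≤ n * (n * (ℓ + 2) * 3) := by
      rw [Finset.sum_const, smul_eq_mul]
      exact Nat.mul_le_mul_right _ (card_finset_fin_le _)
    _ = 3 * (n ^ 2 * (ℓ + 2)) := by ring

end Communication

section Consistency

variable {𝒵 : Finset (Finset (Fin n))} {sender : Fin n} {Z Z₁ Z₂ : Finset (Fin n)}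
  {T : List (Fin n × Fin n × List Bool)} {party : Fin n → AcastState n ℓ}
  {m m' : List.Vector Bool ℓ}

theorem Q.exists_notMem (hQ : Q 3 Finset.univ 𝒵) (hZ : Corruptible 𝒵 Z) (h₁ : Z₁ ∈ 𝒵)
    (h₂ : Z₂ ∈ 𝒵) : ∃ i, i ∉ Z ∧ i ∉ Z₁ ∧ i ∉ Z₂ := by
  obtain ⟨Z₀, h₀, hsub⟩ := hZ
  obtain ⟨i, -, hi⟩ := Finset.not_subset.1 <|
    hQ ![Z₀, Z₁, Z₂] (Fin.forall_fin_succ.2 ⟨h₀, Fin.forall_fin_two.2 ⟨h₁, h₂⟩⟩)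
  simp only [Finset.mem_biUnion, Finset.mem_univ, true_and, not_exists, Fin.forall_fin_succ] at hi
  exact ⟨i, fun h => hi.1 (hsub h), hi.2.1, hi.2.2.1⟩

theorem Q.not_isQuorum_empty (hQ : Q 3 Finset.univ 𝒵) : ¬IsQuorum 𝒵 ∅ := by
  rintro ⟨Z', hZ', hsub⟩
  obtain ⟨i, -, hi, -⟩ := hQ.exists_notMem ⟨Z', hZ', Finset.Subset.refl Z'⟩ hZ' hZ'
  exact absurd (hsub (by simpa using hi)) (Finset.notMem_empty i)

theorem AcastState.Saturated.init (hQ : Q 3 Finset.univ 𝒵) (hZ : Corruptible 𝒵 Z) :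
    (AcastState.init n ℓ).Saturated 𝒵 := by
  have no_senders (m : List.Vector Bool ℓ) : sendersOf (n := n) ∅ m = ∅ := by simp [sendersOf]
  obtain ⟨Z₀, h₀, -⟩ := hZ
  refine ⟨fun m h => ?_, fun m h => ?_, fun m h => ?_⟩ <;>
    rw [AcastState.init, no_senders] at h
  · exact absurd h hQ.not_isQuorum_empty
  · exact absurd ⟨Z₀, h₀, Finset.empty_subset Z₀⟩ h
  · exact absurd h hQ.not_isQuorum_empty

theorem Backed.exists_honest {t : Kind} (h : Backed 𝒵 Z T t m) (hQ : Q 3 Finset.univ 𝒵)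
    (hZ : Corruptible 𝒵 Z) : ∃ i ∉ Z, Said T i t m := by
  obtain ⟨Z', hZ', said⟩ := h
  obtain ⟨i, hi, hi', -⟩ := hQ.exists_notMem hZ hZ' hZ'
  exact ⟨i, hi, said i hi hi'⟩

namespace Sound

/-- Two quorums have an honest party in common, and it sends only one message of each kind. -/
theorem eq_of_backed (h : Sound 𝒵 sender Z T party) (hQ : Q 3 Finset.univ 𝒵)
    (hZ : Corruptible 𝒵 Z) {t : Kind} (hm : Backed 𝒵 Z T t m) (hm' : Backed 𝒵 Z T t m') :
    m = m' := by
  obtain ⟨Z₁, h₁, said⟩ := hm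
  obtain ⟨Z₂, h₂, said'⟩ := hm'
  obtain ⟨i, hi, hi₁, hi₂⟩ := hQ.exists_notMem hZ h₁ h₂
  exact (h i hi).unique (said i hi hi₁) (said' i hi hi₂)

theorem eq_of_said_ready (h : Sound 𝒵 sender Z T party) (hQ : Q 3 Finset.univ 𝒵)
    (hZ : Corruptible 𝒵 Z) {i j : Fin n} (hi : i ∉ Z) (hj : j ∉ Z) (hm : Said T i .ready m)
    (hm' : Said T j .ready m') : m = m' :=
  h.eq_of_backed hQ hZ ((h i hi).ready_backed hm) ((h j hj).ready_backed hm')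

theorem said_inp_of_said_ready (h : Sound 𝒵 sender Z T party) (hQ : Q 3 Finset.univ 𝒵)
    (hZ : Corruptible 𝒵 Z) {i : Fin n} (hi : i ∉ Z) (hm : Said T i .ready m) :
    Said T sender .inp m := by
  obtain ⟨j, hj, hjm⟩ := ((h i hi).ready_backed hm).exists_honest hQ hZ
  exact (h j hj).echo_valid hjm

end Sound

end Consistency

section Liveness

variable {𝒵 : Finset (Finset (Fin n))} {sender : Fin n} {Z : Finset (Fin n)}
  {T : ℕ → List (Fin n × Fin n × List Bool)} {party : ℕ → Fin n → AcastState n ℓ}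
  {m : List.Vector Bool ℓ} {k : ℕ} {i j : Fin n}

theorem isQuorum_sendersOf (hZ : Corruptible 𝒵 Z) {R : Finset (Fin n × List.Vector Bool ℓ)}
    (hR : ∀ j ∉ Z, (j, m) ∈ R) : IsQuorum 𝒵 (sendersOf R m) := by
  obtain ⟨Z₀, h₀, hsub⟩ := hZ
  exact ⟨Z₀, h₀, fun j hj =>
    mem_sendersOf.2 (hR j fun hjZ => (Finset.mem_sdiff.1 hj).2 (hsub hjZ))⟩

/-- What the termination argument uses about an infinite execution of the protocol with eventual
delivery, in which `T k` is the traffic and `party k` the states of the parties after `k` steps. -/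
structure FairExecution (𝒵 : Finset (Finset (Fin n))) (sender : Fin n) (Z : Finset (Fin n))
    (T : ℕ → List (Fin n × Fin n × List Bool)) (party : ℕ → Fin n → AcastState n ℓ) : Prop where
  traffic_mono : ∀ {k k'}, k ≤ k' → T k ⊆ T k'
  party_mono : ∀ {k k'}, k ≤ k' → ∀ i, party k i ≤ party k' i
  sound : ∀ k, Sound 𝒵 sender Z (T k) (party k)
  saturated : ∀ k i, (party k i).Saturated 𝒵
  heard : ∀ {k j i t m}, j ∉ Z → i ∉ Z → Said (T k) j t m → ∃ k', (party k' i).Heard sender j m t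

namespace FairExecution

theorem exists_forall_heard (h : FairExecution 𝒵 sender Z T party) {t : Kind} {H : Fin n → Prop}
    (hH : ∀ j ∉ Z, H j → ∃ k, Said (T k) j t m) (hi : i ∉ Z) :
    ∃ k, ∀ j ∉ Z, H j → (party k i).Heard sender j m t := by
  suffices ∀ j, ∀ᶠ k in Filter.atTop, j ∉ Z → H j → (party k i).Heard sender j m t from
    (Filter.eventually_all.2 this).exists
  intro j
  by_cases hj : j ∉ Z ∧ H j
  · obtain ⟨_, hsaid⟩ := hH j hj.1 hj.2
    obtain ⟨k, hk⟩ := h.heard hj.1 hi hsaid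
    filter_upwards [Filter.eventually_ge_atTop k] with k' hk' _ _
    exact hk.mono (h.party_mono hk' i)
  · exact .of_forall fun _ hjZ hjH => absurd ⟨hjZ, hjH⟩ hj

theorem eq_of_said_ready (h : FairExecution 𝒵 sender Z T party) (hQ : Q 3 Finset.univ 𝒵)
    (hZ : Corruptible 𝒵 Z) {k₁ : ℕ} {m' : List.Vector Bool ℓ} (hi : i ∉ Z) (hj : j ∉ Z)
    (hm : Said (T k) i .ready m) (hm' : Said (T k₁) j .ready m') : m = m' :=
  (h.sound (max k k₁)).eq_of_said_ready hQ hZ hi hj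
    (hm.mono (h.traffic_mono (le_max_left k k₁))) (hm'.mono (h.traffic_mono (le_max_right k k₁)))

/-- A quorum of `ready` messages contains an incorruptible set of honest parties, which makes every
honest party send `ready`. -/
theorem exists_said_ready_of_backed (h : FairExecution 𝒵 sender Z T party)
    (hQ : Q 3 Finset.univ 𝒵) (hZ : Corruptible 𝒵 Z) (hm : Backed 𝒵 Z (T k) .ready m)
    (hi : i ∉ Z) : ∃ k', Said (T k') i .ready m := by
  obtain ⟨j, hj, hjm⟩ := hm.exists_honest hQ hZ
  obtain ⟨Z₁, h₁, said⟩ := hm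
  obtain ⟨k', heard⟩ := h.exists_forall_heard (fun j hj hj₁ => ⟨k, said j hj hj₁⟩) hi
  have incorruptible : ¬Corruptible 𝒵 (sendersOf (party k' i).readies m) := by
    rintro ⟨Z₂, h₂, hsub⟩
    obtain ⟨j, hj, hj₁, hj₂⟩ := hQ.exists_notMem hZ h₁ h₂
    exact hj₂ (hsub (mem_sendersOf.2 (heard j hj hj₁)))
  obtain ⟨m', hm'⟩ :=
    ((h.sound k' i hi).flag_iff .ready).1 ((h.saturated k' i).amplified m incorruptible)
  exact ⟨k', h.eq_of_said_ready hQ hZ hj hi hjm hm' ▸ hm'⟩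

theorem exists_said_echo (h : FairExecution 𝒵 sender Z T party) (hsender : sender ∉ Z)
    (hm : Said (T k) sender .inp m) (hi : i ∉ Z) : ∃ k', Said (T k') i .echo m := by
  obtain ⟨k', heard⟩ := h.heard hsender hi hm
  obtain ⟨m', hm'⟩ := ((h.sound k' i hi).flag_iff .echo).1 (heard rfl)
  have same_input : m = m' :=
    (h.sound (max k k') sender hsender).unique (hm.mono (h.traffic_mono (le_max_left k k')))
      (((h.sound k' i hi).echo_valid hm').mono (h.traffic_mono (le_max_right k k')))
  exact ⟨k', same_input ▸ hm'⟩

theorem exists_said_ready_of_said_inp (h : FairExecution 𝒵 sender Z T party)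
    (hQ : Q 3 Finset.univ 𝒵) (hZ : Corruptible 𝒵 Z) (hsender : sender ∉ Z)
    (hm : Said (T k) sender .inp m) (hi : i ∉ Z) : ∃ k', Said (T k') i .ready m := by
  obtain ⟨k', heard⟩ := h.exists_forall_heard (H := fun _ => True)
    (fun j hj _ => h.exists_said_echo hsender hm hj) hi
  have quorum := isQuorum_sendersOf hZ fun j hj => heard j hj trivial
  obtain ⟨m', hm'⟩ :=
    ((h.sound k' i hi).flag_iff .ready).1 ((h.saturated k' i).confirmed m quorum)
  have same_input : m = m' :=
    (h.sound (max k k') sender hsender).unique (hm.mono (h.traffic_mono (le_max_left k k')))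
      (((h.sound k').said_inp_of_said_ready hQ hZ hi hm').mono
        (h.traffic_mono (le_max_right k k')))
  exact ⟨k', same_input ▸ hm'⟩

theorem exists_finished (h : FairExecution 𝒵 sender Z T party) (hZ : Corruptible 𝒵 Z)
    (hm : ∀ j ∉ Z, ∃ k, Said (T k) j .ready m) (hi : i ∉ Z) :
    ∃ k, (party k i).finished = true := by
  obtain ⟨k, heard⟩ := h.exists_forall_heard (H := fun _ => True) (fun j hj _ => hm j hj) hi
  exact ⟨k, (h.saturated k i).concluded m
    (isQuorum_sendersOf hZ fun j hj => heard j hj trivial)⟩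

end FairExecution

theorem IsRun.fairExecution {A : Adversary n (List.Vector Bool ℓ)}
    (hA : A.EventualDelivery 𝒵 (AcastProtocol 𝒵 ℓ sender)) (hQ : Q 3 Finset.univ 𝒵)
    (hZ : Corruptible 𝒵 Z) {z : List Bool} {a : ℕ → EnvAction n (List.Vector Bool ℓ)}
    {w : ℕ → RealWorld (AcastProtocol 𝒵 ℓ sender) A}
    (hw : IsRun (realStep _ A Z) (RealWorld.start _ A Z z) a w) (ha : IsFair Z a) :
    FairExecution 𝒵 sender Z (fun k => traffic (w k).net) fun k => (w k).party := by
  have sound (k : ℕ) : Sound 𝒵 sender Z (traffic (w k).net) (w k).party :=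
    (preserves_sound hZ).of_le hw k.zero_le (by rw [hw.1]; exact .init)
  constructor
  case traffic_mono => exact fun hk => (hw.traffic_prefix hk).subset
  case party_mono =>
    exact fun hk => (preserves_le _).of_le hw hk fun _ => Preorder.le_refl _
  case sound => exact sound
  case saturated =>
    exact fun k => preserves_saturated.of_le hw k.zero_le (by rw [hw.1]; exact fun _ => .init hQ hZ)
  case heard =>
    intro k j i t m hj hi hm
    obtain ⟨k', hk'⟩ :=
      hA.exists_delivered hZ hw ha hj hi (((sound k) j hj).to_all hm i)
    have heard := preserves_heard.of_le (Z := Z) hw k'.zero_le <| by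
      rw [hw.1]
      rintro _ _ _ _ _ ⟨_, hp, -⟩
      exact absurd hp List.not_mem_nil
    exact ⟨k', heard j i t m hi hk'⟩

end Liveness

section Simulator

variable {In Out Leak AdvMsg : Type} {F : Functionality n In Out Leak AdvMsg}
  {C : SimControl n In Out Leak AdvMsg} {Pr : Protocol n In Out} {A : Adversary n In}
  {Z : Finset (Fin n)} {i : Fin n}

/-- The reaction of `F` when the honest dummy party `i`, activated with input `x`, forwards it. -/
def Functionality.forward (F : Functionality n In Out Leak AdvMsg) (Z : Finset (Fin n)) (i : Fin n)
    (s : F.State) : Option In → F.State × Option Leak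
  | none => (s, none)
  | some m => F.input Z i m s

/-- The functionality executes the commands of the simulator and then answers the request of the
honest party `i`. -/
def IdealWorld.respond {S : Simulator n In Leak AdvMsg} (w : IdealWorld F S) (Z : Finset (Fin n))
    (cmds : List (FCmd n AdvMsg)) (i : Fin n) : IdealWorld F S × Option Out :=
  let f := cmds.foldl (FCmd.apply F Z) (w.func, w.delay)
  IdealWorld.serve ⟨w.sim, f.1, f.2, w.served⟩ i

theorem realStep_activate_congr {v : RealWorld Pr A} {x x' : Option In}
    (h : ∀ recv, Pr.step i (v.party i) x recv = Pr.step i (v.party i) x' recv) (hi : i ∉ Z) :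
    realStep Pr A Z v (.activate i x) = realStep Pr A Z v (.activate i x') := by
  simp only [realStep, hi, if_false, h]

theorem idealStep_toSimulator_passive {w : IdealWorld F (C.toSimulator Pr A)}
    {v : RealWorld Pr A} {b : C.Mem} (hw : w.sim = (v, Z, b)) {a : EnvAction n In}
    (ha : a.IsPassive Z) :
    idealStep F (C.toSimulator Pr A) Z w a = (realStep Pr A Z v a).map fun q =>
      ({ w with sim := (q.1, Z, b) }, ⟨q.2.advMsg, none⟩) := by
  obtain ⟨_, func, delay, served⟩ := w
  subst hw
  rcases a with ⟨i, x⟩ | msg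
  · simp only [idealStep, ha i x rfl, if_true, SimControl.toSimulator, PMF.bind_bind, PMF.pure_bind,
      List.foldl_nil, ← PMF.bind_pure_comp, Function.comp_def]
  · simp only [idealStep, SimControl.toSimulator, PMF.bind_bind, PMF.pure_bind, List.foldl_nil,
      ← PMF.bind_pure_comp, Function.comp_def]

theorem idealStep_toSimulator_activate {w : IdealWorld F (C.toSimulator Pr A)}
    {v : RealWorld Pr A} {b : C.Mem} (hw : w.sim = (v, Z, b)) (hi : i ∉ Z) (x : Option In)
    {s : F.State} {l : Option Leak} (hsl : F.forward Z i w.func x = (s, l)) :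
    idealStep F (C.toSimulator Pr A) Z w (.activate i x) =
      (realStep Pr A Z v (.activate i (C.input b i l))).map fun q =>
        let c := C.react b i l q.2.out
        let u := IdealWorld.respond (S := C.toSimulator Pr A)
          ⟨(q.1, Z, c.1), s, w.delay, w.served⟩ Z c.2 i
        (u.1, ⟨q.2.advMsg, u.2⟩) := by
  obtain ⟨_, func, delay, served⟩ := w
  subst hw
  obtain ⟨rfl, rfl⟩ := Prod.mk.inj hsl
  rcases x with _ | m
  all_goals
    simp only [idealStep, hi, if_false, SimControl.toSimulator, PMF.bind_bind, PMF.pure_bind,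
      ← PMF.bind_pure_comp, Function.comp_def]
    rfl

namespace IdealWorld

variable {S : Simulator n In Leak AdvMsg} {w : IdealWorld F S}

theorem respond_nil (h : F.output w.func i = none) : w.respond Z [] i = (w, none) := by
  simp only [respond, serve, List.foldl_nil, h]

theorem respond_msg {m : AdvMsg} {y : Out} (h : F.output (F.adv Z m w.func) i = some y)
    (hi : i ∉ w.served) (hdelay : w.delay i = 0) :
    w.respond Z [.msg m] i =
      ({ w with func := F.adv Z m w.func, served := insert i w.served }, some y) := by
  simp only [respond, serve, List.foldl_cons, List.foldl_nil, FCmd.apply, h, hi, hdelay, if_false,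
    if_true]

theorem exists_respond_delay_one {y : Out} (h : F.output w.func i = some y) :
    ∃ delay, w.respond Z [.delay i 1] i = ({ w with delay }, none) ∧
      ∀ j ∉ w.served, delay j = w.delay j := by
  by_cases hi : i ∈ w.served
  · refine ⟨Function.update w.delay i (w.delay i + 1), ?_, fun j hj => Function.update_of_ne ?_ _ _⟩
    · simp only [respond, serve, List.foldl_cons, List.foldl_nil, FCmd.apply, h, hi, if_true]
    · rintro rfl
      exact hj hi
  · exact ⟨w.delay, by simp [respond, serve, FCmd.apply, h, hi], fun _ _ => rfl⟩

end IdealWorld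

/-- The virtual sender gets the message that the functionality passes on. When a virtual honest
party produces an output, the functionality is told so; when it does not although an output is
prepared, the present request is ignored. The memory says whether an output is prepared. -/
def acastControl (n ℓ : ℕ) : SimControl n (List.Vector Bool ℓ) (List.Vector Bool ℓ)
    (List.Vector Bool ℓ) (List.Vector Bool ℓ) where
  Mem := Bool
  finite := inferInstance
  init _ := false
  input _ _ l := l
  react b i l o := (b || l.isSome || o.isSome,
    match o with
    | some m => [.msg m]
    | none => if b || l.isSome then [.delay i 1] else [])

/-- The simulator for the adversary `A`. -/
noncomputable abbrev acastSim (𝒵 : Finset (Finset (Fin n))) (sender : Fin n)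
    (A : Adversary n (List.Vector Bool ℓ)) : Simulator n (List.Vector Bool ℓ)
      (List.Vector Bool ℓ) (List.Vector Bool ℓ) :=
  (acastControl n ℓ).toSimulator (AcastProtocol 𝒵 ℓ sender) A

end Simulator

section Coupling

variable {𝒵 : Finset (Finset (Fin n))} {sender i : Fin n} {Z : Finset (Fin n)}
  {T L : List (Fin n × Fin n × List Bool)} {m : List.Vector Bool ℓ}
  {s : Option (List.Vector Bool ℓ)} {x : Option (List.Vector Bool ℓ)}
  {A : Adversary n (List.Vector Bool ℓ)}

theorem forward_FAcast (hi : i ∉ Z) : (FAcast ℓ sender).forward Z i s x =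
    if i = sender ∧ s = none then (x, x) else (s, none) := by
  rcases x with _ | m
  · split_ifs with h
    · exact congrArg (·, none) h.2
    · rfl
  · simp [Functionality.forward, FAcast, hi]

/-- The functionality, in state `s`, has recorded the message that the virtual execution with
traffic `T` broadcasts: the input of an honest sender, or a message that the honest parties are
bound to output. -/
structure Recorded (𝒵 : Finset (Finset (Fin n))) (sender : Fin n) (Z : Finset (Fin n))
    (T : List (Fin n × Fin n × List Bool)) (s : Option (List.Vector Bool ℓ)) : Prop where
  honest : sender ∉ Z → ∀ m, s = some m ↔ Said T sender .inp m
  corrupt : sender ∈ Z → ∀ m, s = some m → Backed 𝒵 Z T .ready m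

namespace Recorded

theorem append (h : Recorded 𝒵 sender Z T s) (hL : ∀ x ∈ L, x.1 ∈ Z) :
    Recorded 𝒵 sender Z (T ++ L) s where
  honest hs m := (h.honest hs m).trans <| by
    rw [said_append, or_iff_left]
    exact fun ⟨_, hd⟩ => hs (hL _ hd)
  corrupt hs m hm := (h.corrupt hs m hm).mono (List.subset_append_left _ _)

theorem started_eq_false_iff (h : Recorded 𝒵 sender Z T s) (hs : sender ∉ Z)
    {st : AcastState n ℓ} (hst : PartySound 𝒵 sender Z T sender st) :
    st.started = false ↔ s = none := by
  rw [← Bool.not_eq_true, ← Option.not_isSome_iff_eq_none, Option.isSome_iff_exists, not_iff_not]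
  exact (hst.flag_iff .inp).trans (exists_congr fun m => (h.honest hs m).symm)

theorem acastActivation_forward (h : Recorded 𝒵 sender Z T s) (hi : i ∉ Z)
    {st : AcastState n ℓ} (hst : PartySound 𝒵 sender Z T i st) (recv : List (Fin n × List Bool)) :
    acastActivation 𝒵 sender i st ((FAcast ℓ sender).forward Z i s x).2 recv =
      acastActivation 𝒵 sender i st x recv := by
  refine acastActivation_congr ?_
  rintro rfl hstarted
  rw [forward_FAcast hi, if_pos ⟨rfl, (h.started_eq_false_iff hi hst).1 hstarted⟩]

theorem forward (h : Recorded 𝒵 sender Z T s) (hi : i ∉ Z) {st : AcastState n ℓ}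
    (hst : PartySound 𝒵 sender Z T i st) (recv : List (Fin n × List Bool)) :
    Recorded 𝒵 sender Z (T ++ sentBy i (acastActivation 𝒵 sender i st x recv).sent)
      ((FAcast ℓ sender).forward Z i s x).1 := by
  rw [forward_FAcast hi]
  constructor
  · intro hs m
    have : Nonempty (Fin n) := ⟨i⟩
    rw [said_append, ← h.honest hs m, said_sentBy]
    simp only [mem_sent_acastActivation_inp, exists_const]
    rcases eq_or_ne i sender with rfl | hne
    · rw [h.started_eq_false_iff hs hst]
      rcases s with _ | m' <;> simp
    · simp [hne]
  · intro hs m hm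
    rw [if_neg (by rintro ⟨rfl, -⟩; exact hi hs)] at hm
    exact (h.corrupt hs m hm).mono (List.subset_append_left _ _)

theorem adv_eq_some (h : Recorded 𝒵 sender Z T s) {party : Fin n → AcastState n ℓ}
    (hT : Sound 𝒵 sender Z T party) (hQ : Q 3 Finset.univ 𝒵) (hZ : Corruptible 𝒵 Z)
    (hm : Backed 𝒵 Z T .ready m) : (FAcast ℓ sender).adv Z m s = some m := by
  by_cases hs : sender ∈ Z
  · rcases s with _ | m'
    · exact if_pos ⟨hs, rfl⟩
    · rw [hT.eq_of_backed hQ hZ hm (h.corrupt hs m' rfl)]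
      exact if_neg fun h => Option.some_ne_none _ h.2
  · obtain ⟨i, hi, him⟩ := hm.exists_honest hQ hZ
    exact (if_neg fun h => hs h.1).trans
      ((h.honest hs m).2 (hT.said_inp_of_said_ready hQ hZ hi him))

theorem of_backed (h : Recorded 𝒵 sender Z T s) {party : Fin n → AcastState n ℓ}
    (hT : Sound 𝒵 sender Z T party) (hQ : Q 3 Finset.univ 𝒵) (hZ : Corruptible 𝒵 Z)
    (hm : Backed 𝒵 Z T .ready m) : Recorded 𝒵 sender Z T (some m) where
  honest hs m' := by
    rw [← h.honest hs, ← h.adv_eq_some hT hQ hZ hm]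
    exact Eq.congr_left (if_neg fun h => hs h.1)
  corrupt _ _ hm' := Option.some.inj hm' ▸ hm

end Recorded

/-- The simulator runs the real world `v`, and the functionality delivers what `v` does: a party
has obtained its output when its virtual copy has, and no request of the others is going to be
ignored. -/
structure Coupled (𝒵 : Finset (Finset (Fin n))) (sender : Fin n) (Z : Finset (Fin n))
    (v : RealWorld (AcastProtocol 𝒵 ℓ sender) A)
    (w : IdealWorld (FAcast ℓ sender) (acastSim 𝒵 sender A)) : Prop where
  sim : w.sim = (v, Z, Option.isSome (α := List.Vector Bool ℓ) w.func)
  sound : Sound 𝒵 sender Z (traffic v.net) v.party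
  recorded : Recorded 𝒵 sender Z (traffic v.net) w.func
  served : ∀ i ∉ Z, i ∈ w.served ↔ (v.party i).finished = true
  prompt : ∀ i ∉ Z, i ∉ w.served → w.delay i = 0

theorem exists_respond_react_none {S : Simulator n (List.Vector Bool ℓ) (List.Vector Bool ℓ)
    (List.Vector Bool ℓ)} (w : IdealWorld (FAcast ℓ sender) S) {b : Bool}
    {l o : Option (List.Vector Bool ℓ)}
    (hb : Option.isSome (α := List.Vector Bool ℓ) w.func = (b || l.isSome)) (ho : o = none) :
    ∃ delay, w.respond Z ((acastControl n ℓ).react b i l o).2 i = ({ w with delay }, none) ∧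
      ∀ j ∉ w.served, delay j = w.delay j := by
  subst ho
  rcases hs : (show Option (List.Vector Bool ℓ) from w.func) with _ | m
  · have no_command : ((acastControl n ℓ).react b i l none).2 = [] :=
      if_neg (by rw [← hb]; simp [show w.func = none from hs])
    exact ⟨w.delay, no_command ▸ w.respond_nil hs, fun _ _ => rfl⟩
  · have ignore : ((acastControl n ℓ).react b i l none).2 = [.delay i 1] :=
      if_pos (by rw [← hb]; simp [show w.func = some m from hs])
    exact ignore ▸ w.exists_respond_delay_one hs

theorem respond_react_some {S : Simulator n (List.Vector Bool ℓ) (List.Vector Bool ℓ)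
    (List.Vector Bool ℓ)} (w : IdealWorld (FAcast ℓ sender) S) {b : Bool}
    {l o : Option (List.Vector Bool ℓ)} (ho : o = some m)
    (hadv : (FAcast ℓ sender).adv Z m w.func = some m) (hi : i ∉ w.served)
    (hdelay : w.delay i = 0) :
    w.respond Z ((acastControl n ℓ).react b i l o).2 i =
      (⟨w.sim, some m, w.delay, insert i w.served⟩, some m) := by
  subst ho
  exact (w.respond_msg hadv hi hdelay).trans (by rw [hadv])

theorem exists_of_mem_support_realStep_acast {v : RealWorld (AcastProtocol 𝒵 ℓ sender) A}
    (hi : i ∉ Z) {q : RealWorld (AcastProtocol 𝒵 ℓ sender) A × Obs (List.Vector Bool ℓ)}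
    (hq : q ∈ (realStep _ A Z v (.activate i x)).support) :
    ∃ L recv c, (∀ y ∈ L, y.1 ∈ Z) ∧ (∀ {r}, r ∈ recv → (r.1, i, r.2) ∈ traffic v.net ++ L) ∧
      c = acastActivation 𝒵 sender i (v.party i) x recv ∧
      q.1.party = Function.update v.party i c.st ∧
      traffic q.1.net = traffic v.net ++ L ++ sentBy i c.sent ∧ q.2.out = c.out := by
  obtain ⟨cmds, _, rfl, r, hr, hparty, hnet, hout⟩ :=
    exists_of_mem_support_realStep_activate hi hq
  obtain ⟨L, hL, hLZ⟩ := exists_traffic_foldl_apply Z cmds v.net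
  obtain rfl := (PMF.mem_support_pure_iff _ _).1 hr
  refine ⟨L, _, _, hLZ, fun hr => hL ▸ mem_traffic_of_mem_released hr, rfl, hparty, ?_, hout⟩
  rw [hnet, traffic_append, traffic_afterFetch, traffic_outgoing, hL]

theorem isSome_forward_FAcast (hi : i ∉ Z) :
    Option.isSome (α := List.Vector Bool ℓ) ((FAcast ℓ sender).forward Z i s x).1 =
      (s.isSome || ((FAcast ℓ sender).forward Z i s x).2.isSome) := by
  rw [forward_FAcast hi]
  split_ifs with h
  · simp [h.2]
  · simp

theorem Recorded.realStep {v : RealWorld (AcastProtocol 𝒵 ℓ sender) A}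
    (h : Recorded 𝒵 sender Z (traffic v.net) s) (hv : Sound 𝒵 sender Z (traffic v.net) v.party)
    (hi : i ∉ Z) {q : RealWorld (AcastProtocol 𝒵 ℓ sender) A × Obs (List.Vector Bool ℓ)}
    (hq : q ∈ (AsyncUC.realStep _ A Z v (.activate i x)).support) :
    Recorded 𝒵 sender Z (traffic q.1.net) ((FAcast ℓ sender).forward Z i s x).1 := by
  obtain ⟨L, recv, c, hL, -, rfl, -, hnet, -⟩ := exists_of_mem_support_realStep_acast hi hq
  exact hnet ▸ (h.append hL).forward hi (hv.append hL i hi) recv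

theorem finished_update (party : Fin n → AcastState n ℓ) (i j : Fin n) (st : AcastState n ℓ) :
    (Function.update party i st j).finished =
      if j = i then st.finished else (party j).finished := by
  rw [Function.update_apply]
  split_ifs <;> rfl

theorem Sound.output_of_mem_support {v : RealWorld (AcastProtocol 𝒵 ℓ sender) A}
    (h : Sound 𝒵 sender Z (traffic v.net) v.party) (hZ : Corruptible 𝒵 Z) (hi : i ∉ Z)
    {q : RealWorld (AcastProtocol 𝒵 ℓ sender) A × Obs (List.Vector Bool ℓ)}
    (hq : q ∈ (realStep _ A Z v (.activate i x)).support) :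
    (q.2.out = none ∧ ∀ j, (q.1.party j).finished = (v.party j).finished) ∨
      ∃ m, q.2.out = some m ∧ Backed 𝒵 Z (traffic q.1.net) .ready m ∧
        (v.party i).finished = false ∧
        ∀ j, (q.1.party j).finished = true ↔ j = i ∨ (v.party j).finished = true := by
  obtain ⟨L, recv, c, hL, hrecv, rfl, hparty, hnet, hout⟩ :=
    exists_of_mem_support_realStep_acast hi hq
  have moves := moves_acastActivation 𝒵 sender i x recv (v.party i)
  have hupdate (j : Fin n) := hparty ▸ finished_update v.party i j
    (acastActivation 𝒵 sender i (v.party i) x recv).st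
  rcases moves.out_eq_none_or_exists rfl with ⟨hnone, hfin⟩ | ⟨m, hsome, hfin, hfin'⟩
  · refine .inl ⟨hout.trans hnone, fun j => (hupdate j).trans ?_⟩
    split_ifs with hji
    · rw [hfin, hji]
    · rfl
  · have backed := ((h.append hL).moves hZ hi hrecv moves).2 hsome
    refine .inr ⟨m, hout.trans hsome, hnet ▸ backed, hfin, fun j => ?_⟩
    rw [hupdate]
    split_ifs with hji
    · exact iff_of_true hfin' (.inl hji)
    · exact (or_iff_right hji).symm

namespace Coupled

variable {v : RealWorld (AcastProtocol 𝒵 ℓ sender) A}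
  {w : IdealWorld (FAcast ℓ sender) (acastSim 𝒵 sender A)}

theorem start (z : List Bool) : Coupled 𝒵 sender Z (RealWorld.start _ A Z z)
    (IdealWorld.start (FAcast ℓ sender) (acastSim 𝒵 sender A) Z z) where
  sim := rfl
  sound := .init
  recorded := ⟨fun _ m => by simp [RealWorld.start, IdealWorld.start, FAcast, traffic, Said],
    fun _ _ h => nomatch h⟩
  served i _ := iff_of_false (Finset.notMem_empty i) Bool.false_ne_true
  prompt _ _ _ := rfl

theorem passive (h : Coupled 𝒵 sender Z v w) {a : EnvAction n (List.Vector Bool ℓ)}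
    (ha : a.IsPassive Z) {q : RealWorld (AcastProtocol 𝒵 ℓ sender) A × Obs (List.Vector Bool ℓ)}
    (hq : q ∈ (realStep _ A Z v a).support) :
    Coupled 𝒵 sender Z q.1
      { w with sim := (q.1, Z, Option.isSome (α := List.Vector Bool ℓ) w.func) } := by
  obtain ⟨hparty, -, cmds, hnet⟩ := exists_of_mem_support_realStep_passive ha hq
  obtain ⟨L, hL, hLZ⟩ := exists_traffic_foldl_apply Z cmds v.net
  rw [← hnet] at hL
  constructor
  case sim => rfl
  case sound => exact hL ▸ hparty ▸ h.sound.append hLZ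
  case recorded => exact hL ▸ h.recorded.append hLZ
  case served => exact hparty ▸ h.served
  case prompt => exact h.prompt

theorem realStep_forward (h : Coupled 𝒵 sender Z v w) (hi : i ∉ Z) :
    realStep _ A Z v (.activate i ((FAcast ℓ sender).forward Z i w.func x).2) =
      realStep _ A Z v (.activate i x) := by
  refine realStep_activate_congr (fun recv => ?_) hi
  exact congrArg (fun c => PMF.pure (c.st, c.sent, c.out))
    (h.recorded.acastActivation_forward hi (h.sound i hi) recv)

theorem respond (h : Coupled 𝒵 sender Z v w) (hQ : Q 3 Finset.univ 𝒵) (hZ : Corruptible 𝒵 Z)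
    (hi : i ∉ Z) {q : RealWorld (AcastProtocol 𝒵 ℓ sender) A × Obs (List.Vector Bool ℓ)}
    (hq : q ∈ (realStep _ A Z v (.activate i x)).support) {l : Option (List.Vector Bool ℓ)}
    (hsl : (FAcast ℓ sender).forward Z i w.func x = (s, l)) :
    let c := (acastControl n ℓ).react (Option.isSome (α := List.Vector Bool ℓ) w.func) i l q.2.out
    let u := IdealWorld.respond (S := acastSim 𝒵 sender A)
      ⟨(q.1, Z, c.1), s, w.delay, w.served⟩ Z c.2 i
    u.2 = q.2.out ∧ Coupled 𝒵 sender Z q.1 u.1 := by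
  intro c u
  have sound : Sound 𝒵 sender Z (traffic q.1.net) q.1.party :=
    (preserves_sound hZ).realStep h.sound hq
  have recorded := h.recorded.realStep h.sound hi hq
  have hs := isSome_forward_FAcast (sender := sender) (s := w.func) (x := x) hi
  rw [hsl] at recorded hs
  have memory : c.1 = (s.isSome || q.2.out.isSome) := congrArg (· || q.2.out.isSome) hs.symm
  rcases h.sound.output_of_mem_support hZ hi hq with ⟨hout, hfin⟩ | ⟨m, hout, backed, hfin, hfin'⟩
  · obtain ⟨delay, hu, hdelay⟩ : ∃ delay, u = (⟨(q.1, Z, c.1), s, delay, w.served⟩, none) ∧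
        ∀ j ∉ w.served, delay j = w.delay j := exists_respond_react_none _ hs hout
    rw [hu]
    refine ⟨hout.symm, ?_, sound, recorded, fun j hj => ?_, fun j hj hserved => ?_⟩
    · exact congrArg (fun b => (q.1, Z, b)) <| memory.trans <| by
        rw [hout]
        exact Bool.or_false _
    · rw [hfin j]
      exact h.served j hj
    · exact (hdelay j hserved).trans (h.prompt j hj hserved)
  · have unserved : i ∉ w.served := by simp [h.served i hi, hfin]
    have hu : u = (⟨(q.1, Z, c.1), some m, w.delay, insert i w.served⟩, some m) :=
      respond_react_some _ hout (recorded.adv_eq_some sound hQ hZ backed) unserved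
        (h.prompt i hi unserved)
    rw [hu]
    refine ⟨hout.symm, ?_, sound, recorded.of_backed sound hQ hZ backed, fun j hj => ?_,
      fun j hj hserved => ?_⟩
    · exact congrArg (fun b => (q.1, Z, b)) <| memory.trans <| by
        rw [hout]
        exact Bool.or_true _
    · rw [hfin' j, Finset.mem_insert, h.served j hj]
    · exact h.prompt j hj fun hmem => hserved (Finset.mem_insert_of_mem hmem)

end Coupled

end Coupling

section Security

variable {𝒵 : Finset (Finset (Fin n))} {sender : Fin n} {Z : Finset (Fin n)}
  {A : Adversary n (List.Vector Bool ℓ)}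

theorem isSimulation_coupled (hQ : Q 3 Finset.univ 𝒵) (hZ : Corruptible 𝒵 Z) :
    IsSimulation (realStep (AcastProtocol 𝒵 ℓ sender) A Z)
      (idealStep (FAcast ℓ sender) (acastSim 𝒵 sender A) Z) (Coupled 𝒵 sender Z) := by
  intro v w h a
  by_cases ha : a.IsPassive Z
  · refine ⟨_, idealStep_toSimulator_passive h.sim ha, fun q hq => ⟨?_, h.passive ha hq⟩⟩
    obtain ⟨-, hout, -⟩ := exists_of_mem_support_realStep_passive ha hq
    exact congrArg (Obs.mk q.2.advMsg) hout.symm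
  · simp only [EnvAction.IsPassive, not_forall] at ha
    obtain ⟨i, x, rfl, hi⟩ := ha
    have step := idealStep_toSimulator_activate h.sim hi x rfl
    refine ⟨_, step.trans (congrArg (PMF.map _) (h.realStep_forward hi)), fun q hq => ?_⟩
    obtain ⟨hout, hnext⟩ := h.respond hQ hZ hi hq rfl
    exact ⟨congrArg (Obs.mk q.2.advMsg) hout, hnext⟩

theorem eventualDelivery_acastSim (hQ : Q 3 Finset.univ 𝒵)
    (hA : A.EventualDelivery 𝒵 (AcastProtocol 𝒵 ℓ sender)) :
    (acastSim 𝒵 sender A).EventualDelivery 𝒵 (FAcast ℓ sender) := by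
  intro Z hZ z a w hw ha k i hi hk
  obtain ⟨v, hv, coupled⟩ := (isSimulation_coupled hQ hZ).exists_isRun (Coupled.start z) hw
  have fair := hv.fairExecution hA hQ hZ ha
  obtain ⟨m, hm⟩ := Option.ne_none_iff_exists'.1 hk
  have all_ready : ∀ j ∉ Z, ∃ k', Said (traffic (v k').net) j .ready m := by
    intro j hj
    by_cases hs : sender ∈ Z
    · exact fair.exists_said_ready_of_backed hQ hZ ((coupled k).recorded.corrupt hs m hm) hj
    · exact fair.exists_said_ready_of_said_inp hQ hZ hs
        (((coupled k).recorded.honest hs m).1 hm) hj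
  obtain ⟨k', finished⟩ := fair.exists_finished hZ all_ready hi
  exact ⟨k', ((coupled k').served i hi).2 finished⟩

theorem ucSecurelyRealizes_acastProtocol (hQ : Q 3 Finset.univ 𝒵) (ℓ : ℕ) (sender : Fin n) :
    UCSecurelyRealizes 𝒵 (AcastProtocol 𝒵 ℓ sender) (FAcast ℓ sender) := fun A =>
  ⟨acastSim 𝒵 sender A, ⟨acastControl n ℓ, rfl⟩, eventualDelivery_acastSim hQ,
    fun _ hZ z E k => (isSimulation_coupled hQ hZ).exec_eq E k E.init none (Coupled.start z)⟩

end Security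

theorem Protocol.CommunicationAtMost.mono {In Out : Type} {𝒵 : Finset (Finset (Fin n))}
    {Pr : Protocol n In Out} {B B' : ℕ} (h : Pr.CommunicationAtMost 𝒵 B) (hB : B ≤ B') :
    Pr.CommunicationAtMost 𝒵 B' :=
  fun A Z hZ z a w hw k => (h A Z hZ z a w hw k).trans hB

end AsyncUC

theorem mainTheorem10_general {n : ℕ} (𝒵 : Finset (Finset (Fin n))) (ℓ : ℕ) (sender : Fin n) :
    (AsyncUC.Q 3 Finset.univ 𝒵 →
      AsyncUC.UCSecurelyRealizes 𝒵 (AsyncUC.AcastProtocol 𝒵 ℓ sender) (AsyncUC.FAcast ℓ sender)) ∧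
    (AsyncUC.AcastProtocol 𝒵 ℓ sender).CommunicationAtMost 𝒵 (3 * (n ^ 2 * (ℓ + 2))) :=
  ⟨fun hQ => AsyncUC.ucSecurelyRealizes_acastProtocol hQ ℓ sender,
    AsyncUC.acastProtocol_communicationAtMost 𝒵 ℓ sender⟩

theorem mainTheorem10 :
    ∃ c : ℕ, ∀ (n : ℕ) (𝒵 : Finset (Finset (Fin n))) (ℓ : ℕ) (sender : Fin n),
      AsyncUC.Q 3 Finset.univ 𝒵 →
        AsyncUC.UCSecurelyRealizes 𝒵 (AsyncUC.AcastProtocol 𝒵 ℓ sender) (AsyncUC.FAcast ℓ sender) ∧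
        (1 ≤ ℓ →
          (AsyncUC.AcastProtocol 𝒵 ℓ sender).CommunicationAtMost 𝒵 (c * (n ^ 2 * ℓ))) := by
  refine ⟨9, fun n 𝒵 ℓ sender hQ => ?_⟩
  obtain ⟨secure, communication⟩ := mainTheorem10_general 𝒵 ℓ sender
  refine ⟨secure hQ, fun hℓ => communication.mono ?_⟩
  calc 3 * (n ^ 2 * (ℓ + 2)) ≤ 3 * (n ^ 2 * (3 * ℓ)) := by gcongr; omega
    _ = 9 * (n ^ 2 * ℓ) := by ring
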